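/- Equip $SL_n(\mathbb{C})$ with its Zariski topology, whose closed sets are the zero loci of families of complex polynomials in the matrix entries. Let $G\subset SL_n(\mathbb{C})$ be a Zariski closed subgroup, possibly disconnected, which is reductive: its unipotent radical, i.e. its largest Zariski connected, normal, unipotent, Zariski closed subgroup, is trivial. Let $N$ be either $G$ itself or, in case $G$ is defined over $\mathbb{R}$ (cut out by polynomials with real coefficients), the group $G(\mathbb{R})=G\cap SL_n(\mathbb{R})$ of its real points. Suppose that $N$ is nilpotent as an abstract group. Then: 1. Every element of $N$ is semisimple, i.e. $\mathbb{C}^n$ is spanned by its eigenvectors. 2. $N$ has a unique maximal compact subgroup, where compactness refers to the classical (Hausdorff) topology and a maximal compact subgroup is one that is maximal under inclusion among the compact subgroups of $N$. 3. The connected component $N^o$ of the identity of $N$, in the Zariski topology, is contained in the centre of $N$. -/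

import Mathlib

namespace AlgGroup

/-- `SL_n(ℂ)`. Its `TopologicalSpace` instance is the classical (Hausdorff) topology. -/
abbrev SLC (n : ℕ) : Type := Matrix.SpecialLinearGroup (Fin n) ℂ

/-- `Z ⊆ SL_n(ℂ)` is the zero locus in `SL_n(ℂ)` of a family of polynomials in the matrix
entries with coefficients in `k` (used for `k = ℂ` and `k = ℝ`). -/
def IsAlgebraicSet (k : Type) [Field k] [Algebra k ℂ] {n : ℕ} (Z : Set (SLC n)) : Prop :=
  ∃ S : Set (MvPolynomial (Fin n × Fin n) k),
    Z = {g : SLC n | ∀ p ∈ S,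
      MvPolynomial.aeval (fun ij : Fin n × Fin n => (g : Matrix (Fin n) (Fin n) ℂ) ij.1 ij.2) p = 0}

theorem isAlgebraicSet_empty {n : ℕ} : IsAlgebraicSet ℂ (∅ : Set (SLC n)) := by
  refine ⟨{1}, ?_⟩
  ext g
  simp

theorem IsAlgebraicSet.sInter {n : ℕ} (A : Set (Set (SLC n)))
    (hA : ∀ Z ∈ A, IsAlgebraicSet ℂ Z) : IsAlgebraicSet ℂ (⋂₀ A) := by
  refine ⟨{p | ∃ Z ∈ A, ∀ g ∈ Z,
    MvPolynomial.aeval (fun ij : Fin n × Fin n => (g : Matrix (Fin n) (Fin n) ℂ) ij.1 ij.2) p = 0}, ?_⟩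
  ext g
  constructor
  · rintro hg p ⟨Z, hZ, hp⟩
    exact hp g (hg Z hZ)
  · intro hg Z hZ
    obtain ⟨S, rfl⟩ := hA Z hZ
    intro p hp
    exact hg p ⟨_, hZ, fun h hh => hh p hp⟩

theorem IsAlgebraicSet.union {n : ℕ} (Z : Set (SLC n)) (hZ : IsAlgebraicSet ℂ Z)
    (W : Set (SLC n)) (hW : IsAlgebraicSet ℂ W) : IsAlgebraicSet ℂ (Z ∪ W) := by
  obtain ⟨S, rfl⟩ := hZ
  obtain ⟨T, rfl⟩ := hW
  refine ⟨{r | ∃ p ∈ S, ∃ q ∈ T, r = p * q}, ?_⟩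
  ext g
  constructor
  · rintro (hg | hg) r ⟨p, hp, q, hq, rfl⟩
    · rw [map_mul, hg p hp, zero_mul]
    · rw [map_mul, hg q hq, mul_zero]
  · intro hg
    by_contra hne
    rw [Set.mem_union, not_or] at hne
    obtain ⟨h1, h2⟩ := hne
    simp only [Set.mem_ofPred_eq, not_forall] at h1 h2
    obtain ⟨p, hp, hp0⟩ := h1
    obtain ⟨q, hq, hq0⟩ := h2
    have h := hg (p * q) ⟨p, hp, q, hq, rfl⟩
    rw [map_mul] at h
    exact (mul_ne_zero hp0 hq0) h

/-- The Zariski topology on `SL_n(ℂ)`. It is not an instance. -/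
abbrev zariskiTopology (n : ℕ) : TopologicalSpace (SLC n) :=
  TopologicalSpace.ofClosed {Z | IsAlgebraicSet ℂ Z} isAlgebraicSet_empty
    (fun A hA => IsAlgebraicSet.sInter A fun _ hZ => hA hZ)
    (fun Z hZ W hW => IsAlgebraicSet.union Z hZ W hW)

/-- The Zariski closed subgroups of `SL_n(ℂ)`, i.e. the (complex linear) algebraic groups. -/
def IsZariskiClosed {n : ℕ} (G : Subgroup (SLC n)) : Prop :=
  @IsClosed _ (zariskiTopology n) (G : Set (SLC n))

/-- `G` is connected in the Zariski topology. -/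
def IsZariskiConnected {n : ℕ} (G : Subgroup (SLC n)) : Prop :=
  @IsConnected _ (zariskiTopology n) (G : Set (SLC n))

/-- The connected component `N°` of the identity of `N`, in the Zariski topology of `N`. -/
def identityComponent {n : ℕ} (N : Subgroup (SLC n)) : Set (SLC n) :=
  @connectedComponentIn _ (zariskiTopology n) (N : Set (SLC n)) 1

/-- `G` is defined over `ℝ`: it is cut out by polynomials with real coefficients. -/
def IsDefinedOverReal {n : ℕ} (G : Subgroup (SLC n)) : Prop :=
  IsAlgebraicSet ℝ (G : Set (SLC n))

/-- The group `G(ℝ)` of those elements of `G` that have real entries. -/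
def realPoints {n : ℕ} (G : Subgroup (SLC n)) : Subgroup (SLC n) :=
  G ⊓ (Matrix.SpecialLinearGroup.map (n := Fin n) Complex.ofRealHom).range

/-- An endomorphism of a complex vector space is semisimple if its eigenvectors span. -/
def IsSemisimpleEnd {V : Type} [AddCommGroup V] [Module ℂ V] (σ : Module.End ℂ V) : Prop :=
  Submodule.span ℂ {v : V | ∃ μ : ℂ, σ.HasEigenvector μ v} = ⊤

/-- `g ∈ SL_n(ℂ)` is semisimple as an endomorphism of `ℂⁿ`. -/
def IsSemisimpleElement {n : ℕ} (g : SLC n) : Prop :=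
  IsSemisimpleEnd (Matrix.toLin' (g : Matrix (Fin n) (Fin n) ℂ))

/-- `g ∈ SL_n(ℂ)` is unipotent as an endomorphism of `ℂⁿ`. -/
def IsUnipotentElement {n : ℕ} (g : SLC n) : Prop :=
  IsNilpotent (Matrix.toLin' (g : Matrix (Fin n) (Fin n) ℂ) - LinearMap.id)

/-- `U` is a Zariski connected, normal, unipotent algebraic subgroup of `G`. -/
def IsConnectedNormalUnipotent {n : ℕ} (G U : Subgroup (SLC n)) : Prop :=
  U ≤ G ∧ (U.subgroupOf G).Normal ∧ IsZariskiClosed U ∧ IsZariskiConnected U ∧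
    ∀ u ∈ U, IsUnipotentElement u

/-- The unipotent radical of `G`: the subgroup generated by all the connected normal unipotent
algebraic subgroups of `G`, which is the largest one of them when `G` is algebraic. -/
def unipotentRadical {n : ℕ} (G : Subgroup (SLC n)) : Subgroup (SLC n) :=
  sSup {U | IsConnectedNormalUnipotent G U}

/-- The algebraic group `G` is reductive: its unipotent radical is trivial. No connectedness
of `G` is required. -/
def IsReductive {n : ℕ} (G : Subgroup (SLC n)) : Prop :=
  unipotentRadical G = ⊥

/-- `C` is maximal among the subgroups of `N` that are compact in the classical topology. -/
def IsMaximalCompactSubgroup {n : ℕ} (N C : Subgroup (SLC n)) : Prop :=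
  Maximal (fun H : Subgroup (SLC n) => H ≤ N ∧ IsCompact (H : Set (SLC n))) C

end AlgGroup

/-! Semisimplicity. In `G`, the unipotent elements commuting with every unipotent element form a
normal closed unipotent subgroup. It is connected because the complex powers `z ^ t` of a unipotent
`z` stay in it, so reductivity makes it trivial (`eq_one_of_commute_unipotent`). A unipotent `u` in
the centre of `N` belongs to it. For `N = G` this is immediate. For real points, `u` commutes with
the real elements of the Lie algebra of `G`, and these span it over `ℂ`, so `u` commutes with the
logarithms of all unipotents. An induction along the upper central series
(`eq_one_of_forall_center`) then removes all unipotents of `N`, central or not. The unipotent Jordan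
factor of an element of `N` lies in `N` again, so it is `1`.

Centrality of `N°`. Climb the upper central series, with `x` at level `j + 1`. Some iterate of `c y
= x y x⁻¹ y⁻¹` is trivial on `N°`, and the number of iterations can be lowered to one. If the next
iterate is trivial, then `w = c z` commutes with `x`, and with `z` by induction, so `w ^ m * z = x ^
m * z * x ^ (-m)`. Hence multiplying by powers of `w` permits only finitely many eigenvalues, and
those of `w` are roots of unity of bounded order. On a connected set the characteristic polynomial
of `w` is then constant; being semisimple, `w` is `1`.

Maximal compact subgroup. Noetherianity and the centrality of `N°` make the centre of finite index
`m`, so the transfer `g ↦ g ^ m` is a homomorphism to the centre. Thus the elements with all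
eigenvalues on the unit circle form a subgroup. Every compact subgroup lies in it, and it is itself
compact since commuting semisimple elements with such eigenvalues are simultaneously diagonal, hence
bounded. -/

namespace AlgGroup

/-! ### Exponential polynomials in an exponent and an independent variable -/

open Polynomial in
/-- Exponential polynomials with the exponent and the polynomial variable kept apart. -/
def IsExpPoly (F : ℕ → ℂ → ℂ) : Prop :=
  ∃ c : ℂˣ →₀ ℂ[X], ∀ a t, F a t = c.sum fun l p => p.eval t * (l : ℂ) ^ a

namespace IsExpPoly

theorem term (p : Polynomial ℂ) (l : ℂˣ) : IsExpPoly fun a t => p.eval t * (l : ℂ) ^ a :=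
  ⟨Finsupp.single l p, fun a t => by simp⟩

theorem const (z : ℂ) : IsExpPoly fun _ _ => z := by
  simpa using term (Polynomial.C z) 1

theorem add {F G : ℕ → ℂ → ℂ} (hF : IsExpPoly F) (hG : IsExpPoly G) :
    IsExpPoly fun a t => F a t + G a t := by
  obtain ⟨c, hc⟩ := hF
  obtain ⟨d, hd⟩ := hG
  refine ⟨c + d, fun a t => ?_⟩
  beta_reduce
  rw [hc, hd, Finsupp.sum_add_index'] <;> intros <;> simp [add_mul]

theorem sum {ι : Type*} (s : Finset ι) {F : ι → ℕ → ℂ → ℂ} (hF : ∀ i ∈ s, IsExpPoly (F i)) :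
    IsExpPoly fun a t => ∑ i ∈ s, F i a t := by
  classical
  induction s using Finset.induction_on with
  | empty => simpa using const 0
  | insert i s hi ih =>
    simp only [Finset.sum_insert hi]
    exact (hF i (by simp)).add (ih fun j hj => hF j (by simp [hj]))

theorem mul {F G : ℕ → ℂ → ℂ} (hF : IsExpPoly F) (hG : IsExpPoly G) :
    IsExpPoly fun a t => F a t * G a t := by
  obtain ⟨c, hc⟩ := hF
  obtain ⟨d, hd⟩ := hG
  have h : (fun a t => F a t * G a t) = fun a t => ∑ l ∈ c.support, ∑ m ∈ d.support,
      ((c l * d m).eval t * ((l * m : ℂˣ) : ℂ) ^ a) := by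
    funext a t
    rw [hc, hd, Finsupp.sum, Finsupp.sum, Finset.sum_mul_sum]
    refine Finset.sum_congr rfl fun l _ => Finset.sum_congr rfl fun m _ => ?_
    simp only [Polynomial.eval_mul, Units.val_mul, mul_pow]
    ring
  rw [h]
  exact sum _ fun l _ => sum _ fun m _ => term _ _

/-- The shift operator on sequences. -/
def shift : Module.End ℂ (ℕ → ℂ) where
  toFun u m := u (m + 1)
  map_add' _ _ := rfl
  map_smul' _ _ := rfl

/-- The operator `shift - l` replaces `p` by `l * (p(m + 1) - p(m))`, of smaller degree, and kills
constants. -/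
theorem mem_maxGenEigenspace_shift (l : ℂˣ) (d : ℕ) (p : Polynomial ℂ) (hp : p.natDegree < d) :
    (fun m : ℕ => p.eval (m : ℂ) * (l : ℂ) ^ m) ∈ shift.maxGenEigenspace (l : ℂ) := by
  induction d generalizing p with
  | zero => omega
  | succ d ih =>
    rw [Module.End.mem_maxGenEigenspace]
    set q : Polynomial ℂ := Polynomial.C (l : ℂ) * (Polynomial.taylor 1 p - p) with hq
    have hstep : (shift - (l : ℂ) • (1 : Module.End ℂ (ℕ → ℂ)))
        (fun m : ℕ => p.eval (m : ℂ) * (l : ℂ) ^ m) =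
        fun m : ℕ => q.eval (m : ℂ) * (l : ℂ) ^ m := by
      funext m
      simp [shift, hq, Polynomial.taylor_eval, pow_succ]
      ring_nf
    rcases Nat.eq_zero_or_pos p.natDegree with h0 | h0
    · refine ⟨1, ?_⟩
      rw [pow_one, hstep]
      rw [Polynomial.natDegree_eq_zero] at h0
      obtain ⟨x, rfl⟩ := h0
      funext m
      simp [hq]
    · have hlt : q.natDegree < d := by
        have h1 : (Polynomial.taylor 1 p - p).natDegree < p.natDegree := by
          by_cases hz : Polynomial.taylor 1 p - p = 0
          · simpa [hz] using h0
          · refine Polynomial.natDegree_lt_natDegree hz ?_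
            rw [← Polynomial.degree_taylor p 1]
            refine Polynomial.degree_sub_lt_left (by simp) ?_ (by simp)
            rintro h
            simp_all
        exact (Polynomial.natDegree_C_mul_le _ _).trans_lt (by omega)
      obtain ⟨k, hk⟩ := (Module.End.mem_maxGenEigenspace _ _ _).1 (ih q hlt)
      refine ⟨k + 1, ?_⟩
      rw [pow_succ, Module.End.mul_apply, hstep, hk]

/-- Generalized eigenspaces of the shift are independent, so vanishing on the diagonal already kills
every coefficient polynomial. Exponent and variable can afterwards be chosen separately, which is
what splits off unipotent Jordan factors. -/
theorem eq_zero {F : ℕ → ℂ → ℂ} (hF : IsExpPoly F) (h : ∀ m : ℕ, F m m = 0) (a : ℕ) (t : ℂ) :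
    F a t = 0 := by
  obtain ⟨c, hc⟩ := hF
  have hind : iSupIndep fun l : ℂˣ => shift.maxGenEigenspace (l : ℂ) :=
    shift.independent_maxGenEigenspace.comp Units.val_injective
  rw [iSupIndep_iff_finsetSum_eq_zero_imp_eq_zero] at hind
  have h1 := hind c.support (fun l (m : ℕ) => (c l).eval (m : ℂ) * (l : ℂ) ^ m)
    (fun l _ => mem_maxGenEigenspace_shift l _ (c l) (Nat.lt_succ_self _)) (by
      funext m
      simpa [hc, Finsupp.sum] using h m)
  rw [hc, Finsupp.sum]
  refine Finset.sum_eq_zero fun l hl => ?_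
  -- Since `l` is a unit, the factor `l ^ m` cancels and `c l` has every natural number as a root.
  have h2 : c l = 0 := by
    refine Polynomial.eq_zero_of_infinite_isRoot _ ?_
    refine (Set.infinite_range_of_injective (Nat.cast_injective (R := ℂ))).mono ?_
    rintro _ ⟨m, rfl⟩
    have h3 := congrFun (h1 l hl) m
    simpa using h3
  simp [h2]

end IsExpPoly

/-! ### Polynomial functions and complex powers of unipotent matrices -/

/-- Polynomial functions of one complex variable. -/
def IsPolyFun (f : ℂ → ℂ) : Prop := ∃ p : Polynomial ℂ, ∀ t, f t = p.eval t

namespace IsPolyFun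

theorem const (c : ℂ) : IsPolyFun fun _ => c := ⟨Polynomial.C c, by simp⟩

theorem eval (p : Polynomial ℂ) : IsPolyFun fun t => p.eval t := ⟨p, fun _ => rfl⟩

theorem add {f g : ℂ → ℂ} (hf : IsPolyFun f) (hg : IsPolyFun g) :
    IsPolyFun fun t => f t + g t := by
  obtain ⟨p, hp⟩ := hf
  obtain ⟨q, hq⟩ := hg
  exact ⟨p + q, fun t => by simp [hp, hq]⟩

theorem mul {f g : ℂ → ℂ} (hf : IsPolyFun f) (hg : IsPolyFun g) :
    IsPolyFun fun t => f t * g t := by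
  obtain ⟨p, hp⟩ := hf
  obtain ⟨q, hq⟩ := hg
  exact ⟨p * q, fun t => by simp [hp, hq]⟩

theorem sub {f g : ℂ → ℂ} (hf : IsPolyFun f) (hg : IsPolyFun g) :
    IsPolyFun fun t => f t - g t := by
  obtain ⟨p, hp⟩ := hf
  obtain ⟨q, hq⟩ := hg
  exact ⟨p - q, fun t => by simp [hp, hq]⟩

theorem sum {ι : Type*} (s : Finset ι) {f : ι → ℂ → ℂ} (hf : ∀ i ∈ s, IsPolyFun (f i)) :
    IsPolyFun fun t => ∑ i ∈ s, f i t := by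
  classical
  induction s using Finset.induction_on with
  | empty => simpa using const 0
  | insert i s hi ih =>
    simp only [Finset.sum_insert hi]
    exact (hf i (by simp)).add (ih fun j hj => hf j (by simp [hj]))

theorem comp_const_add {f : ℂ → ℂ} (hf : IsPolyFun f) (c : ℂ) : IsPolyFun fun t => f (c + t) := by
  obtain ⟨p, hp⟩ := hf
  exact ⟨p.comp (Polynomial.C c + Polynomial.X), fun t => by simp [hp]⟩

theorem eq_zero {f : ℂ → ℂ} (hf : IsPolyFun f) (h : ∀ m : ℕ, f m = 0) (t : ℂ) : f t = 0 := by
  obtain ⟨p, hp⟩ := hf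
  have : p = 0 := by
    refine Polynomial.eq_zero_of_infinite_isRoot _ ?_
    refine (Set.infinite_range_of_injective (Nat.cast_injective (R := ℂ))).mono ?_
    rintro _ ⟨m, rfl⟩
    exact (hp m).symm.trans (h m)
  simp [hp, this]

end IsPolyFun

/-- The functional equation gives `V' = V * V'(0)`, so `V t * exp (-t V'(0))` has zero derivative.
-/
theorem exists_eq_exp_of_map_add {A : Type*} [NormedRing A] [NormedAlgebra ℂ A] [CompleteSpace A]
    {V : ℂ → A} (hd : Differentiable ℂ V) (hV0 : V 0 = 1) (hadd : ∀ s t, V (s + t) = V s * V t) :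
    ∃ X : A, ∀ t : ℂ, V t = NormedSpace.exp (t • X) := by
  have hder : ∀ t, HasDerivAt V (V t * deriv V 0) t := by
    intro t
    have h1 : HasDerivAt (fun s => V t * V s) (V t * deriv V 0) 0 :=
      (hd 0).hasDerivAt.const_mul (V t)
    simp only [← hadd] at h1
    have h3 : HasDerivAt (fun s => V (t + s)) (V t * deriv V 0) (t - t) := by simpa using h1
    simpa using h3.comp_sub_const t t
  refine ⟨deriv V 0, fun t => ?_⟩
  set X := deriv V 0
  have hW : ∀ t, HasDerivAt (fun t => V t * NormedSpace.exp (t • (-X))) 0 t := by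
    intro t
    have := (hder t).mul (hasDerivAt_exp_smul_const' (𝕂 := ℂ) (-X) t)
    convert! this using 1
    noncomm_ring
  have hc := is_const_of_deriv_eq_zero (fun t => (hW t).differentiableAt) (fun t => (hW t).deriv) t 0
  simp only [hV0, zero_smul, neg_zero, NormedSpace.exp_zero, mul_one, smul_neg] at hc
  have : NormedAlgebra ℚ A := NormedAlgebra.restrictScalars ℚ ℂ A
  have hu := NormedSpace.exp_add_of_commute (Commute.refl (t • X)).neg_left
  rw [neg_add_cancel, NormedSpace.exp_zero] at hu
  calc V t = V t * (NormedSpace.exp (-(t • X)) * NormedSpace.exp (t • X)) := by rw [← hu, mul_one]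
    _ = _ := by rw [← mul_assoc, hc, one_mul]

section UnipotentPowers

open scoped Matrix.Norms.Operator

variable {n : ℕ}

/-- The polynomial `t ↦ t(t-1)⋯(t-k+1)/k!`. -/
noncomputable def binomialPoly (k : ℕ) : Polynomial ℂ :=
  Polynomial.C ((k.factorial : ℂ)⁻¹) * descPochhammer ℂ k

theorem binomialPoly_eval_natCast (k m : ℕ) : (binomialPoly k).eval (m : ℂ) = m.choose k := by
  rw [binomialPoly, Polynomial.eval_mul, Polynomial.eval_C, descPochhammer_eval_eq_descFactorial,
    Nat.descFactorial_eq_factorial_mul_choose, Nat.cast_mul, inv_mul_cancel_left₀]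
  exact_mod_cast k.factorial_ne_zero

/-- The complex powers of `1 + N` for `N ^ d = 0`. -/
noncomputable def unipotentPow (d : ℕ) (N : Matrix (Fin n) (Fin n) ℂ) (t : ℂ) :
    Matrix (Fin n) (Fin n) ℂ :=
  ∑ k ∈ Finset.range d, (binomialPoly k).eval t • N ^ k

variable {d : ℕ} {N : Matrix (Fin n) (Fin n) ℂ}

theorem isPolyFun_unipotentPow (i j : Fin n) : IsPolyFun fun t => unipotentPow d N t i j := by
  simp only [unipotentPow, Matrix.sum_apply, Matrix.smul_apply, smul_eq_mul]
  exact .sum _ fun k _ => (IsPolyFun.eval _).mul (.const _)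

theorem unipotentPow_natCast (hN : N ^ d = 0) (m : ℕ) :
    unipotentPow d N (m : ℂ) = (1 + N) ^ m := by
  rw [add_comm, (Commute.one_right N).add_pow, unipotentPow]
  simp only [binomialPoly_eval_natCast, one_pow, mul_one]
  have h1 : ∀ k, ((m.choose k : ℕ) : ℂ) • N ^ k = N ^ k * ((m.choose k : ℕ) : Matrix _ _ ℂ) := by
    intro k
    rw [← nsmul_eq_mul', Nat.cast_smul_eq_nsmul]
  simp only [h1]
  rcases le_total d (m + 1) with h | h
  · refine Finset.sum_subset (Finset.range_mono h) fun k _ hk => ?_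
    rw [Finset.mem_range, not_lt] at hk
    rw [pow_eq_zero_of_le hk hN, zero_mul]
  · refine (Finset.sum_subset (Finset.range_mono h) fun k _ hk => ?_).symm
    rw [Finset.mem_range, not_lt] at hk
    rw [Nat.choose_eq_zero_of_lt (by omega), Nat.cast_zero, mul_zero]

/-- Both sides are polynomial in each variable and agree at natural numbers; one variable is freed
at a time. -/
theorem unipotentPow_add (hN : N ^ d = 0) (s t : ℂ) :
    unipotentPow d N (s + t) = unipotentPow d N s * unipotentPow d N t := by
  have hmul : ∀ (A : ℂ → Matrix (Fin n) (Fin n) ℂ) (B : ℂ → Matrix (Fin n) (Fin n) ℂ) (i j : Fin n),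
      (∀ i j, IsPolyFun fun t => A t i j) → (∀ i j, IsPolyFun fun t => B t i j) →
      IsPolyFun fun t => (A t * B t) i j := by
    intro A B i j hA hB
    simp only [Matrix.mul_apply]
    exact .sum _ fun k _ => (hA i k).mul (hB k j)
  have h1 : ∀ (m : ℕ) (t : ℂ),
      unipotentPow d N (m + t) = unipotentPow d N m * unipotentPow d N t := by
    intro m t
    ext i j
    rw [← sub_eq_zero]
    refine IsPolyFun.eq_zero (f := fun t => unipotentPow d N (m + t) i j -
      (unipotentPow d N m * unipotentPow d N t) i j)
      (((isPolyFun_unipotentPow i j).comp_const_add _).sub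
        (hmul (fun _ => _) _ i j (fun i j => .const _) isPolyFun_unipotentPow)) (fun k => ?_) t
    rw [← Nat.cast_add, unipotentPow_natCast hN, unipotentPow_natCast hN, unipotentPow_natCast hN,
      pow_add, sub_self]
  ext i j
  rw [← sub_eq_zero, add_comm]
  refine IsPolyFun.eq_zero (f := fun s => unipotentPow d N (t + s) i j -
      (unipotentPow d N s * unipotentPow d N t) i j)
      (((isPolyFun_unipotentPow i j).comp_const_add _).sub
        (hmul _ (fun _ => _) i j isPolyFun_unipotentPow (fun i j => .const _))) (fun k => ?_) s
  rw [add_comm, h1, sub_self]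

theorem exists_unipotentPow_eq_exp (hN : N ^ d = 0) :
    ∃ X : Matrix (Fin n) (Fin n) ℂ, ∀ t : ℂ, unipotentPow d N t = NormedSpace.exp (t • X) := by
  set V := unipotentPow d N with hV
  have hd : Differentiable ℂ V := by
    have : V = fun t => ∑ k ∈ Finset.range d, (binomialPoly k).eval t • N ^ k := rfl
    rw [this]
    exact Differentiable.fun_sum fun k _ => (Polynomial.differentiable _).smul_const _
  exact exists_eq_exp_of_map_add hd (by simpa using unipotentPow_natCast hN 0)
    (unipotentPow_add hN)

end UnipotentPowers

/-- A logarithm of a unipotent matrix. -/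
theorem exists_log_of_unipotent {n : ℕ} {v : Matrix (Fin n) (Fin n) ℂ} (hv : IsNilpotent (v - 1)) :
    ∃ X : Matrix (Fin n) (Fin n) ℂ, (∀ m : ℕ, NormedSpace.exp ((m : ℂ) • X) = v ^ m) ∧
      ∀ i j, IsPolyFun fun t => NormedSpace.exp (t • X) i j := by
  obtain ⟨d, hd⟩ := hv
  obtain ⟨X, hX⟩ := exists_unipotentPow_eq_exp hd
  refine ⟨X, fun m => ?_, fun i j => ?_⟩
  · rw [← hX, unipotentPow_natCast hd, add_sub_cancel]
  · simp only [← hX]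
    exact isPolyFun_unipotentPow i j

variable {n : ℕ}

theorem IsPolyFun.matrix_mul {A B : ℂ → Matrix (Fin n) (Fin n) ℂ}
    (hA : ∀ i j, IsPolyFun fun t => A t i j) (hB : ∀ i j, IsPolyFun fun t => B t i j) (i j : Fin n) :
    IsPolyFun fun t => (A t * B t) i j := by
  simp only [Matrix.mul_apply]
  exact .sum _ fun k _ => (hA i k).mul (hB k j)

theorem IsPolyFun.matrix_pow {A : ℂ → Matrix (Fin n) (Fin n) ℂ}
    (hA : ∀ i j, IsPolyFun fun t => A t i j) (k : ℕ) (i j : Fin n) :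
    IsPolyFun fun t => (A t ^ k) i j := by
  induction k generalizing i j with
  | zero => simpa using .const _
  | succ k ih => simpa only [pow_succ] using .matrix_mul ih hA i j

theorem commute_exp_smul {v X w : Matrix (Fin n) (Fin n) ℂ}
    (hX : ∀ m : ℕ, NormedSpace.exp ((m : ℂ) • X) = v ^ m)
    (hp : ∀ i j, IsPolyFun fun t => NormedSpace.exp (t • X) i j)
    (h : Commute w v) (t : ℂ) :
    Commute w (NormedSpace.exp (t • X)) := by
  rw [Commute, SemiconjBy]
  ext i j
  rw [← sub_eq_zero]
  refine IsPolyFun.eq_zero (f := fun t => (w * NormedSpace.exp (t • X)) i j -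
    (NormedSpace.exp (t • X) * w) i j) ((IsPolyFun.matrix_mul (fun i j => .const (w i j)) hp i j).sub
      (IsPolyFun.matrix_mul hp (fun i j => .const (w i j)) i j)) (fun m => ?_) t
  rw [hX, (h.pow_right m).eq, sub_self]

/-- At natural `t`, the commuting factor `v - 1` divides `v ^ t - 1`, so one exponent `d` works for
all of them. Vanishing of the `d`-th power then extends to all complex `t` by polynomiality. -/
theorem isNilpotent_exp_smul_sub_one {v X : Matrix (Fin n) (Fin n) ℂ}
    (hX : ∀ m : ℕ, NormedSpace.exp ((m : ℂ) • X) = v ^ m)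
    (hp : ∀ i j, IsPolyFun fun t => NormedSpace.exp (t • X) i j)
    (hv : IsNilpotent (v - 1)) (t : ℂ) :
    IsNilpotent (NormedSpace.exp (t • X) - 1) := by
  obtain ⟨d, hd⟩ := hv
  refine ⟨d, ?_⟩
  ext i j
  refine IsPolyFun.eq_zero (f := fun t => ((NormedSpace.exp (t • X) - 1) ^ d) i j)
    (IsPolyFun.matrix_pow (fun i j => ?_) d i j) (fun m => ?_) t
  · simp only [Matrix.sub_apply]
    exact (hp i j).sub (.const _)
  · rw [hX, ← mul_geom_sum, Commute.mul_pow, hd, zero_mul, Matrix.zero_apply]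
    exact Commute.sum_right _ _ _ fun i _ =>
      ((Commute.refl v).sub_left (Commute.one_left v)).pow_right i

/-! ### Polynomials in the matrix entries and membership in closed subgroups -/

/-- Evaluation of a polynomial in the matrix entries. -/
noncomputable abbrev entryEval (A : Matrix (Fin n) (Fin n) ℂ) :
    MvPolynomial (Fin n × Fin n) ℂ →ₐ[ℂ] ℂ :=
  MvPolynomial.aeval fun ij => A ij.1 ij.2

theorem isExpPoly_entryEval {M : ℕ → ℂ → Matrix (Fin n) (Fin n) ℂ}
    (hM : ∀ i j, IsExpPoly fun a t => M a t i j) (f : MvPolynomial (Fin n × Fin n) ℂ) :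
    IsExpPoly fun a t => entryEval (M a t) f := by
  induction f using MvPolynomial.induction_on with
  | C c => simpa using .const c
  | add p q hp hq => simpa using hp.add hq
  | mul_X p ij hp => simpa using hp.mul (hM ij.1 ij.2)

theorem isExpPoly_pow_apply {s : Matrix (Fin n) (Fin n) ℂ} (hs : IsSemisimpleEnd (Matrix.toLin' s))
    (hu : IsUnit s) (i j : Fin n) : IsExpPoly fun a _ => (s ^ a) i j := by
  let W : Submodule ℂ (Fin n → ℂ) :=
    { carrier := {w | ∀ i, IsExpPoly fun a _ => (s ^ a).mulVec w i}
      add_mem' := fun {x y} hx hy i => by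
        simpa only [Matrix.mulVec_add, Pi.add_apply] using (hx i).add (hy i)
      zero_mem' := fun i => by simpa using .const 0
      smul_mem' := fun c x hx i => by
        simpa only [Matrix.mulVec_smul, Pi.smul_apply, smul_eq_mul] using (IsExpPoly.const c).mul (hx i) }
  -- On eigenvectors the orbit is `μ ^ a • w`, with `μ ≠ 0` because `s` is invertible;
  -- semisimplicity says that these vectors span.
  have hW : W = ⊤ := by
    rw [eq_top_iff, ← hs, Submodule.span_le]
    rintro w ⟨μ, hw⟩ i
    have hμ : μ ≠ 0 := by
      rintro rfl
      apply hw.2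
      have h0 : s.mulVec w = 0 := by simpa using hw.apply_eq_smul
      have := (Matrix.mulVec_injective_iff_isUnit.2 hu) (a₁ := w) (a₂ := 0)
      exact this (by simpa using h0)
    have hpow : ∀ a, (s ^ a).mulVec w = μ ^ a • w := by
      intro a
      induction a with
      | zero => simp
      | succ a ih =>
        have h0 : s.mulVec w = μ • w := by simpa using hw.apply_eq_smul
        rw [pow_succ, ← Matrix.mulVec_mulVec, h0, Matrix.mulVec_smul, ih, smul_smul, pow_succ,
          mul_comm]
    simp only [hpow, Pi.smul_apply, smul_eq_mul]
    simpa [mul_comm] using IsExpPoly.term (Polynomial.C (w i)) (Units.mk0 μ hμ)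
  have hj : Pi.single j 1 ∈ W := hW ▸ Submodule.mem_top
  simpa using hj i

/-- Polynomials vanishing on the positive powers of `s * v` vanish on `s ^ a * v ^ t`. -/
theorem entryEval_pow_mul_exp_eq_zero {s v X : Matrix (Fin n) (Fin n) ℂ}
    (hs : IsSemisimpleEnd (Matrix.toLin' s)) (hu : IsUnit s)
    (hX : ∀ m : ℕ, NormedSpace.exp ((m : ℂ) • X) = v ^ m)
    (hp : ∀ i j, IsPolyFun fun t => NormedSpace.exp (t • X) i j)
    (f : MvPolynomial (Fin n × Fin n) ℂ) (h : ∀ m : ℕ, entryEval (s ^ m * v ^ m) f = 0)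
    (a : ℕ) (t : ℂ) : entryEval (s ^ a * NormedSpace.exp (t • X)) f = 0 := by
  refine IsExpPoly.eq_zero (F := fun a t => entryEval (s ^ a * NormedSpace.exp (t • X)) f)
    (isExpPoly_entryEval (fun i j => ?_) f) (fun m => by rw [hX, h]) a t
  simp only [Matrix.mul_apply]
  refine IsExpPoly.sum _ fun k _ => (isExpPoly_pow_apply hs hu i k).mul ?_
  obtain ⟨p, hp⟩ := hp k j
  simpa [hp] using IsExpPoly.term p 1

/-- The determinant as a polynomial in the entries. -/
noncomputable def detPoly (n : ℕ) : MvPolynomial (Fin n × Fin n) ℂ :=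
  (Matrix.mvPolynomialX (Fin n) (Fin n) ℂ).det

theorem entryEval_detPoly (A : Matrix (Fin n) (Fin n) ℂ) : entryEval A (detPoly n) = A.det := by
  rw [detPoly, AlgHom.map_det, Matrix.mvPolynomialX_mapMatrix_aeval]

theorem isClosed_zariski_iff {Z : Set (SLC n)} :
    @IsClosed _ (zariskiTopology n) Z ↔ IsAlgebraicSet ℂ Z := by
  rw [← @isOpen_compl_iff _ _ (zariskiTopology n)]
  change IsAlgebraicSet ℂ Zᶜᶜ ↔ _
  rw [compl_compl]

theorem mem_of_forall_entryEval {G : Subgroup (SLC n)} (hG : IsZariskiClosed G)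
    (A : Matrix (Fin n) (Fin n) ℂ)
    (h : ∀ f, (∀ g ∈ G, entryEval (g : Matrix (Fin n) (Fin n) ℂ) f = 0) → entryEval A f = 0) :
    ∃ w ∈ G, (w : Matrix (Fin n) (Fin n) ℂ) = A := by
  have hdet : A.det = 1 := by
    have := h (detPoly n - 1) fun g _ => by rw [map_sub, entryEval_detPoly, g.2, map_one, sub_self]
    rwa [map_sub, entryEval_detPoly, map_one, sub_eq_zero] at this
  obtain ⟨S, hS⟩ := isClosed_zariski_iff.1 hG
  have hmem : ∀ g : SLC n, g ∈ G ↔ ∀ p ∈ S, entryEval (g : Matrix (Fin n) (Fin n) ℂ) p = 0 :=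
    fun g => Set.ext_iff.1 hS g
  refine ⟨(⟨A, hdet⟩ : SLC n), (hmem _).2 fun p hpS => h p fun g hg => ?_, rfl⟩
  exact (hmem g).1 hg p hpS

/-! ### The Lie algebra of a closed subgroup -/

section Tangent

open MvPolynomial

/-- The left invariant derivation of the coordinate ring in the direction `X`. -/
noncomputable def invDeriv (X : Matrix (Fin n) (Fin n) ℂ) :
    Derivation ℂ (MvPolynomial (Fin n × Fin n) ℂ) (MvPolynomial (Fin n × Fin n) ℂ) :=
  mkDerivation ℂ fun ij => ∑ k, MvPolynomial.X (ij.1, k) * C (X k ij.2)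

theorem invDeriv_add (X Y : Matrix (Fin n) (Fin n) ℂ) : invDeriv (X + Y) = invDeriv X + invDeriv Y := by
  refine MvPolynomial.derivation_ext fun ij => ?_
  simp [invDeriv, mul_add, Finset.sum_add_distrib]

open scoped Matrix.Norms.Operator in
theorem hasDerivAt_mul_exp_apply (A X : Matrix (Fin n) (Fin n) ℂ) (t : ℂ) (i j : Fin n) :
    HasDerivAt (fun t : ℂ => (A * NormedSpace.exp (t • X)) i j)
      ((A * NormedSpace.exp (t • X) * X) i j) t := by
  have h := (hasDerivAt_exp_smul_const (𝕂 := ℂ) X t).const_mul A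
  rw [← mul_assoc] at h
  exact ((Matrix.entryLinearMap ℂ ℂ i j).toContinuousLinearMap.hasFDerivAt).comp_hasDerivAt t h

theorem hasDerivAt_entryEval (A X : Matrix (Fin n) (Fin n) ℂ) (f : MvPolynomial (Fin n × Fin n) ℂ)
    (t : ℂ) : HasDerivAt (fun t : ℂ => entryEval (A * NormedSpace.exp (t • X)) f)
      (entryEval (A * NormedSpace.exp (t • X)) (invDeriv X f)) t := by
  induction f using MvPolynomial.induction_on with
  | C c =>
    simpa using hasDerivAt_const t c
  | add p q hp hq =>
    simp only [map_add]
    exact hp.add hq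
  | mul_X p ij hp =>
    have h := hp.mul (hasDerivAt_mul_exp_apply A X t ij.1 ij.2)
    convert! h using 1
    · funext t
      simp
    · rw [Matrix.mul_apply (M := A * _)]
      simp [invDeriv, mkDerivation_X]
      ring

/-- `X` lies in the Lie algebra of `G`. -/
def IsTangent (G : Subgroup (SLC n)) (X : Matrix (Fin n) (Fin n) ℂ) : Prop :=
  ∀ t : ℂ, ∃ w ∈ G, (w : Matrix (Fin n) (Fin n) ℂ) = NormedSpace.exp (t • X)

theorem IsTangent.smul {G : Subgroup (SLC n)} {X : Matrix (Fin n) (Fin n) ℂ} (hX : IsTangent G X)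
    (c : ℂ) : IsTangent G (c • X) := fun t => by
  simpa [smul_smul] using hX (t * c)

theorem IsTangent.invDeriv_vanish {G : Subgroup (SLC n)} {X : Matrix (Fin n) (Fin n) ℂ}
    (hX : IsTangent G X) {f : MvPolynomial (Fin n × Fin n) ℂ}
    (hf : ∀ g ∈ G, entryEval (g : Matrix (Fin n) (Fin n) ℂ) f = 0) :
    ∀ g ∈ G, entryEval (g : Matrix (Fin n) (Fin n) ℂ) (invDeriv X f) = 0 := by
  intro g hg
  have h0 : (fun t : ℂ => entryEval ((g : Matrix (Fin n) (Fin n) ℂ) * NormedSpace.exp (t • X)) f) =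
      fun _ => 0 := by
    funext t
    obtain ⟨w, hw, hwX⟩ := hX t
    rw [← hwX, ← Matrix.SpecialLinearGroup.coe_mul]
    exact hf _ (mul_mem hg hw)
  have h1 := hasDerivAt_entryEval (g : Matrix (Fin n) (Fin n) ℂ) X f 0
  rw [h0] at h1
  have h2 := h1.unique (hasDerivAt_const _ _)
  simpa using h2

/-- The function `t ↦ f (exp (t X))` is entire, and its `k`-th derivative at `0` is the value at `1`
of the `k`-fold derivation of `f`. These values all vanish, hence so does the Taylor series. -/
theorem isTangent_of_invDeriv {G : Subgroup (SLC n)} (hG : IsZariskiClosed G)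
    {X : Matrix (Fin n) (Fin n) ℂ}
    (h : ∀ f : MvPolynomial (Fin n × Fin n) ℂ,
      (∀ g ∈ G, entryEval (g : Matrix (Fin n) (Fin n) ℂ) f = 0) →
      ∀ g ∈ G, entryEval (g : Matrix (Fin n) (Fin n) ℂ) (invDeriv X f) = 0) : IsTangent G X := by
  intro t
  refine mem_of_forall_entryEval hG _ fun f hf => ?_
  have hvan : ∀ k, ∀ g ∈ G,
      entryEval (g : Matrix (Fin n) (Fin n) ℂ) ((invDeriv X)^[k] f) = 0 := by
    intro k
    induction k with
    | zero => exact hf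
    | succ k ih =>
      rw [Function.iterate_succ_apply']
      exact h _ ih
  have hder : ∀ p, deriv (fun t : ℂ => entryEval (NormedSpace.exp (t • X)) p) =
      fun t : ℂ => entryEval (NormedSpace.exp (t • X)) (invDeriv X p) := by
    intro p
    funext t
    simpa using (hasDerivAt_entryEval 1 X p t).deriv
  have hit : ∀ k, iteratedDeriv k (fun t : ℂ => entryEval (NormedSpace.exp (t • X)) f) =
      fun t : ℂ => entryEval (NormedSpace.exp (t • X)) ((invDeriv X)^[k] f) := by
    intro k
    induction k with
    | zero => simp
    | succ k ih => rw [iteratedDeriv_succ, ih, hder, Function.iterate_succ_apply']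
  have hdiff : Differentiable ℂ (fun t : ℂ => entryEval (NormedSpace.exp (t • X)) f) := fun t => by
    simpa using (hasDerivAt_entryEval 1 X f t).differentiableAt
  have := Complex.taylorSeries_eq_of_entire' 0 t hdiff
  rw [← this]
  have h1 : ∀ k, entryEval (1 : Matrix (Fin n) (Fin n) ℂ) ((invDeriv X)^[k] f) = 0 := fun k => by
    simpa using hvan k 1 (one_mem G)
  refine (tsum_congr fun k => ?_).trans tsum_zero
  rw [hit]
  beta_reduce
  rw [zero_smul, NormedSpace.exp_zero, h1, mul_zero, zero_mul]

/-- The exponential of a sum is not a product, but `invDeriv` is additive in its direction, so the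
infinitesimal criterion passes to sums. -/
theorem IsTangent.add {G : Subgroup (SLC n)} (hG : IsZariskiClosed G)
    {X Y : Matrix (Fin n) (Fin n) ℂ} (hX : IsTangent G X) (hY : IsTangent G Y) :
    IsTangent G (X + Y) :=
  isTangent_of_invDeriv hG fun f hf g hg => by
    rw [invDeriv_add, Derivation.add_apply, map_add, hX.invDeriv_vanish hf g hg,
      hY.invDeriv_vanish hf g hg, add_zero]

end Tangent

/-! ### Unipotent elements, Zariski closed conditions and the unipotent radical -/

theorem isUnipotentElement_iff {g : SLC n} :
    IsUnipotentElement g ↔ IsNilpotent ((g : Matrix (Fin n) (Fin n) ℂ) - 1) := by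
  rw [IsUnipotentElement, ← Matrix.toLin'_one, ← map_sub]
  exact (IsNilpotent.map_iff (f := (Matrix.toLinAlgEquiv' : _ ≃ₐ[ℂ] Module.End ℂ (Fin n → ℂ)))
    (Matrix.toLinAlgEquiv' : _ ≃ₐ[ℂ] Module.End ℂ (Fin n → ℂ)).injective)

theorem commute_coe_iff {g h : SLC n} :
    Commute (g : Matrix (Fin n) (Fin n) ℂ) (h : Matrix (Fin n) (Fin n) ℂ) ↔ Commute g h := by
  rw [Commute, SemiconjBy, Commute, SemiconjBy, ← Matrix.SpecialLinearGroup.coe_mul,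
    ← Matrix.SpecialLinearGroup.coe_mul]
  exact Subtype.val_injective.eq_iff

namespace IsUnipotentElement

theorem one : IsUnipotentElement (1 : SLC n) := by
  simp [isUnipotentElement_iff]

theorem mul {g h : SLC n} (hc : Commute g h) (hg : IsUnipotentElement g)
    (hh : IsUnipotentElement h) : IsUnipotentElement (g * h) := by
  rw [isUnipotentElement_iff] at *
  rw [← commute_coe_iff] at hc
  have h1 : ((g * h : SLC n) : Matrix (Fin n) (Fin n) ℂ) - 1 =
      ((g : Matrix (Fin n) (Fin n) ℂ) - 1) * h + ((h : Matrix (Fin n) (Fin n) ℂ) - 1) := by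
    rw [Matrix.SpecialLinearGroup.coe_mul]
    noncomm_ring
  have hc1 : Commute ((g : Matrix (Fin n) (Fin n) ℂ) - 1) (h : Matrix (Fin n) (Fin n) ℂ) :=
    hc.sub_left (Commute.one_left _)
  have hc2 : Commute (((g : Matrix (Fin n) (Fin n) ℂ) - 1) * h)
      ((h : Matrix (Fin n) (Fin n) ℂ) - 1) :=
    (hc1.mul_left (Commute.refl _)).sub_right (Commute.one_right _)
  rw [h1]
  exact hc2.isNilpotent_add (hc1.isNilpotent_mul_right hg) hh

theorem inv {g : SLC n} (hg : IsUnipotentElement g) : IsUnipotentElement g⁻¹ := by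
  rw [isUnipotentElement_iff] at *
  have h0 : ((g⁻¹ : SLC n) : Matrix (Fin n) (Fin n) ℂ) * g = 1 := by
    rw [← Matrix.SpecialLinearGroup.coe_mul, inv_mul_cancel, Matrix.SpecialLinearGroup.coe_one]
  have h1 : ((g⁻¹ : SLC n) : Matrix (Fin n) (Fin n) ℂ) - 1 =
      (-((g⁻¹ : SLC n) : Matrix (Fin n) (Fin n) ℂ)) * ((g : Matrix (Fin n) (Fin n) ℂ) - 1) := by
    rw [mul_sub, neg_mul, h0]
    noncomm_ring
  rw [h1]
  refine Commute.isNilpotent_mul_left ?_ hg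
  exact ((commute_coe_iff.2 (Commute.refl g).inv_left).sub_right (Commute.one_right _)).neg_left

theorem conj {g : SLC n} (hg : IsUnipotentElement g) (h : SLC n) :
    IsUnipotentElement (h * g * h⁻¹) := by
  rw [isUnipotentElement_iff] at *
  obtain ⟨k, hk⟩ := hg
  set u : (Matrix (Fin n) (Fin n) ℂ)ˣ :=
    Units.map Matrix.SpecialLinearGroup.coeMonoidHom (toUnits h) with hu
  have h1 : ((h * g * h⁻¹ : SLC n) : Matrix (Fin n) (Fin n) ℂ) - 1 =
      u * ((g : Matrix (Fin n) (Fin n) ℂ) - 1) * (u⁻¹ : (Matrix (Fin n) (Fin n) ℂ)ˣ) := by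
    rw [mul_sub, sub_mul, mul_one, Units.mul_inv]
    rfl
  refine ⟨k, ?_⟩
  rw [h1, Units.conj_pow, hk, mul_zero, zero_mul]

end IsUnipotentElement

theorem isClosed_zariski_setOf (p : MvPolynomial (Fin n × Fin n) ℂ) :
    @IsClosed _ (zariskiTopology n) {g : SLC n | entryEval (g : Matrix (Fin n) (Fin n) ℂ) p = 0} :=
  isClosed_zariski_iff.2 ⟨{p}, by simp⟩

/-- Functions on `SL_n(ℂ)` that are given by polynomials in the matrix entries. -/
def IsRegularFun (F : SLC n → ℂ) : Prop :=
  ∃ p : MvPolynomial (Fin n × Fin n) ℂ, ∀ g : SLC n,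
    F g = entryEval (g : Matrix (Fin n) (Fin n) ℂ) p

namespace IsRegularFun

theorem const (c : ℂ) : IsRegularFun fun _ : SLC n => c := ⟨MvPolynomial.C c, by simp⟩

theorem apply (i j : Fin n) : IsRegularFun fun g : SLC n => g i j :=
  ⟨MvPolynomial.X (i, j), by simp⟩

theorem add {F H : SLC n → ℂ} (hF : IsRegularFun F) (hH : IsRegularFun H) :
    IsRegularFun fun g => F g + H g := by
  obtain ⟨p, hp⟩ := hF
  obtain ⟨q, hq⟩ := hH
  exact ⟨p + q, fun g => by simp [hp, hq]⟩

theorem mul {F H : SLC n → ℂ} (hF : IsRegularFun F) (hH : IsRegularFun H) :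
    IsRegularFun fun g => F g * H g := by
  obtain ⟨p, hp⟩ := hF
  obtain ⟨q, hq⟩ := hH
  exact ⟨p * q, fun g => by simp [hp, hq]⟩

theorem sub {F H : SLC n → ℂ} (hF : IsRegularFun F) (hH : IsRegularFun H) :
    IsRegularFun fun g => F g - H g := by
  simpa [sub_eq_add_neg] using hF.add ((const (-1)).mul hH)

theorem sum {ι : Type*} (s : Finset ι) {F : ι → SLC n → ℂ} (hF : ∀ i ∈ s, IsRegularFun (F i)) :
    IsRegularFun fun g => ∑ i ∈ s, F i g := by
  classical
  induction s using Finset.induction_on with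
  | empty => simpa using const 0
  | insert i s hi ih =>
    simp only [Finset.sum_insert hi]
    exact (hF i (by simp)).add (ih fun j hj => hF j (by simp [hj]))

theorem matrix_mul {A B : SLC n → Matrix (Fin n) (Fin n) ℂ}
    (hA : ∀ i j, IsRegularFun fun g => A g i j) (hB : ∀ i j, IsRegularFun fun g => B g i j)
    (i j : Fin n) : IsRegularFun fun g => (A g * B g) i j := by
  simp only [Matrix.mul_apply]
  exact .sum _ fun k _ => (hA i k).mul (hB k j)

theorem matrix_pow {A : SLC n → Matrix (Fin n) (Fin n) ℂ}
    (hA : ∀ i j, IsRegularFun fun g => A g i j) (k : ℕ) (i j : Fin n) :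
    IsRegularFun fun g => (A g ^ k) i j := by
  induction k generalizing i j with
  | zero => simpa using .const _
  | succ k ih => simpa only [pow_succ] using .matrix_mul ih hA i j

theorem isClosed_setOf_eq_zero {F : SLC n → ℂ} (hF : IsRegularFun F) :
    @IsClosed _ (zariskiTopology n) {g | F g = 0} := by
  obtain ⟨p, hp⟩ := hF
  simpa only [hp] using isClosed_zariski_setOf p

theorem isClosed_setOf_eq {A B : SLC n → Matrix (Fin n) (Fin n) ℂ}
    (hA : ∀ i j, IsRegularFun fun g => A g i j) (hB : ∀ i j, IsRegularFun fun g => B g i j) :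
    @IsClosed _ (zariskiTopology n) {g | A g = B g} := by
  have : {g | A g = B g} = ⋂ i, ⋂ j, {g | A g i j - B g i j = 0} := by
    ext g
    simp [sub_eq_zero, ← Matrix.ext_iff]
  rw [this]
  exact @isClosed_iInter _ _ (zariskiTopology n) _ fun i =>
    @isClosed_iInter _ _ (zariskiTopology n) _ fun j => ((hA i j).sub (hB i j)).isClosed_setOf_eq_zero

end IsRegularFun

/-- By Cayley–Hamilton the exponent can be fixed as `n`, which turns unipotency into a polynomial
condition. -/
theorem isNilpotent_iff_pow_eq_zero (A : Matrix (Fin n) (Fin n) ℂ) : IsNilpotent A ↔ A ^ n = 0 := by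
  refine ⟨fun h => ?_, fun h => ⟨n, h⟩⟩
  have h1 : A.charpoly = Polynomial.X ^ n := by
    simpa [sub_eq_zero] using (Matrix.isNilpotent_charpoly_sub_pow_of_isNilpotent h).eq_zero
  simpa [h1] using A.aeval_self_charpoly

theorem isClosed_zariski_unipotent :
    @IsClosed _ (zariskiTopology n) {g : SLC n | IsUnipotentElement g} := by
  simp only [isUnipotentElement_iff, isNilpotent_iff_pow_eq_zero]
  exact IsRegularFun.isClosed_setOf_eq (.matrix_pow (fun i j => (IsRegularFun.apply i j).sub (.const _)) n)
    (fun i j => .const _)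

theorem isClosed_zariski_commute (v : SLC n) :
    @IsClosed _ (zariskiTopology n) {g : SLC n | Commute g v} := by
  simp only [← commute_coe_iff]
  exact IsRegularFun.isClosed_setOf_eq
    (.matrix_mul (A := fun g : SLC n => (g : Matrix (Fin n) (Fin n) ℂ)) IsRegularFun.apply
      (fun i j => .const _))
    (.matrix_mul (B := fun g : SLC n => (g : Matrix (Fin n) (Fin n) ℂ)) (fun i j => .const _)
      IsRegularFun.apply)

/-- The unipotent elements of `G` have logarithms in the Lie algebra of `G`. -/
theorem IsUnipotentElement.exists_log {G : Subgroup (SLC n)} (hG : IsZariskiClosed G) {v : SLC n}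
    (hvG : v ∈ G) (hv : IsUnipotentElement v) :
    ∃ X : Matrix (Fin n) (Fin n) ℂ,
      (∀ m : ℕ, NormedSpace.exp ((m : ℂ) • X) = (v : Matrix (Fin n) (Fin n) ℂ) ^ m) ∧
      (∀ i j, IsPolyFun fun t => NormedSpace.exp (t • X) i j) ∧ IsTangent G X := by
  obtain ⟨X, hX, hp⟩ := exists_log_of_unipotent (isUnipotentElement_iff.1 hv)
  refine ⟨X, hX, hp, fun t => mem_of_forall_entryEval hG _ fun f hf => ?_⟩
  have h1 : IsSemisimpleEnd (Matrix.toLin' (1 : Matrix (Fin n) (Fin n) ℂ)) := by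
    rw [IsSemisimpleEnd, eq_top_iff]
    intro w _
    by_cases hw : w = 0
    · simp [hw]
    · exact Submodule.subset_span ⟨1, by simp, hw⟩
  have := entryEval_pow_mul_exp_eq_zero h1 isUnit_one hX hp f (fun m => ?_) 0 t
  · simpa using this
  · rw [one_pow, one_mul, ← Matrix.SpecialLinearGroup.coe_pow]
    exact hf _ (pow_mem hvG m)

/-- The curve is continuous from the classical topology of `ℂ` to the Zariski topology, and `ℂ` is
connected. -/
theorem isPreconnected_range_of_exp {X : Matrix (Fin n) (Fin n) ℂ} {w : ℂ → SLC n}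
    (hw : ∀ t, (w t : Matrix (Fin n) (Fin n) ℂ) = NormedSpace.exp (t • X)) :
    @IsPreconnected _ (zariskiTopology n) (Set.range w) := by
  have hc : @Continuous _ _ _ (zariskiTopology n) w := by
    refine (@continuous_iff_isClosed _ _ _ (zariskiTopology n) _).2 fun Z hZ => ?_
    obtain ⟨S, rfl⟩ := isClosed_zariski_iff.1 hZ
    have : w ⁻¹' {g : SLC n | ∀ p ∈ S, entryEval (g : Matrix (Fin n) (Fin n) ℂ) p = 0} =
        ⋂ p ∈ S, {t | entryEval (NormedSpace.exp (t • X)) p = 0} := by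
      ext t
      simp [hw]
    change IsClosed (w ⁻¹' {g : SLC n | ∀ p ∈ S, entryEval (g : Matrix (Fin n) (Fin n) ℂ) p = 0})
    rw [this]
    refine isClosed_biInter fun p _ => isClosed_singleton.preimage (?_ : Continuous _)
    refine continuous_iff_continuousAt.2 fun t => ?_
    simpa using (hasDerivAt_entryEval 1 X p t).continuousAt
  exact @isPreconnected_range _ _ _ (zariskiTopology n) _ _ hc

/-- In a reductive group no nontrivial unipotent element commutes with all the others. -/
theorem eq_one_of_commute_unipotent {G : Subgroup (SLC n)} (hG : IsZariskiClosed G)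
    (hred : IsReductive G) {z : SLC n} (hzG : z ∈ G) (hz : IsUnipotentElement z)
    (hc : ∀ v ∈ G, IsUnipotentElement v → Commute z v) : z = 1 := by
  -- Requiring commutation with all unipotents makes `U` abelian, so products stay unipotent, and
  -- also normal, since conjugation permutes the unipotents of `G`.
  let U : Subgroup (SLC n) :=
    { carrier := {z | z ∈ G ∧ IsUnipotentElement z ∧ ∀ v ∈ G, IsUnipotentElement v → Commute z v}
      one_mem' := ⟨one_mem _, .one, fun v _ _ => Commute.one_left v⟩
      mul_mem' := fun {a b} ha hb => ⟨mul_mem ha.1 hb.1, .mul (ha.2.2 b hb.1 hb.2.1) ha.2.1 hb.2.1,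
        fun v hv huv => (ha.2.2 v hv huv).mul_left (hb.2.2 v hv huv)⟩
      inv_mem' := fun {a} ha => ⟨inv_mem ha.1, ha.2.1.inv, fun v hv huv =>
        (ha.2.2 v hv huv).inv_left⟩ }
  have hU : IsConnectedNormalUnipotent G U := by
    refine ⟨fun z hz => hz.1, ⟨fun z hz g => ?_⟩, ?_, ⟨⟨1, one_mem U⟩, ?_⟩, fun z hz => hz.2.1⟩
    · refine ⟨mul_mem (mul_mem g.2 z.2) (inv_mem g.2), IsUnipotentElement.conj hz.2.1 g,
        fun v hv huv => ?_⟩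
      have h1 := hz.2.2 ((g : SLC n)⁻¹ * v * g) (mul_mem (mul_mem (inv_mem g.2) hv) g.2) (by
        simpa using huv.conj (g : SLC n)⁻¹)
      have h2 := congrArg (fun x => (g : SLC n) * x * (g : SLC n)⁻¹) h1.eq
      rw [Commute, SemiconjBy]
      simpa [mul_assoc] using h2
    · have : (U : Set (SLC n)) = (G : Set (SLC n)) ∩ ({g : SLC n | IsUnipotentElement g} ∩
          ⋂ v ∈ {v | v ∈ G ∧ IsUnipotentElement v}, {g : SLC n | Commute g v}) := by
        ext z
        simp [U]
      rw [IsZariskiClosed, this]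
      exact @IsClosed.inter _ _ _ (zariskiTopology n) hG
        (@IsClosed.inter _ _ _ (zariskiTopology n) isClosed_zariski_unipotent
          (@isClosed_biInter _ _ (zariskiTopology n) _ _ fun v _ => isClosed_zariski_commute v))
    -- Each `z` is joined to `1` inside `U` by its complex powers `exp (t • X)`.
    · refine @isPreconnected_of_forall _ (zariskiTopology n) _ 1 fun z hz => ?_
      obtain ⟨X, hX, hp, hT⟩ := IsUnipotentElement.exists_log hG hz.1 hz.2.1
      choose w hwG hw using hT
      refine ⟨Set.range w, ?_, ⟨0, ?_⟩, ⟨1, ?_⟩, isPreconnected_range_of_exp hw⟩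
      · rintro _ ⟨t, rfl⟩
        refine ⟨hwG t, ?_, fun v hv huv => ?_⟩
        · rw [isUnipotentElement_iff, hw]
          exact isNilpotent_exp_smul_sub_one hX hp (isUnipotentElement_iff.1 hz.2.1) t
        · rw [← commute_coe_iff, hw]
          exact (commute_exp_smul hX hp (commute_coe_iff.2 (hz.2.2 v hv huv).symm) t).symm
      · exact Subtype.ext (by simpa using hw 0)
      · refine Subtype.ext ?_
        have := hX 1
        rw [Nat.cast_one, pow_one] at this
        rw [hw, this]
  have hle : U ≤ unipotentRadical G := le_sSup hU
  rw [show unipotentRadical G = ⊥ from hred] at hle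
  exact hle (show z ∈ U from ⟨hzG, hz, hc⟩)

/-! ### Reduction from nilpotent groups to their centres -/

open scoped commutatorElement in
/-- If the central elements with a property stable under conjugation, inverses and commuting
products are trivial, then so are all such elements of a nilpotent group. -/
theorem eq_one_of_forall_center {H : Type*} [Group H] [Group.IsNilpotent H] (U : H → Prop)
    (hconj : ∀ u, U u → ∀ g, U (g * u * g⁻¹)) (hinv : ∀ u, U u → U u⁻¹)
    (hmul : ∀ u v, Commute u v → U u → U v → U (u * v))
    (hcen : ∀ u ∈ Subgroup.center H, U u → u = 1) (u : H) (hu : U u) : u = 1 := by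
  -- Both halves are needed at once: the first at level `j` makes the factors of the next commutator
  -- commute, and the second then shows that this commutator is trivial.
  have key : ∀ j, ∀ c ∈ Subgroup.upperCentralSeries H j,
      (∀ u, U u → Commute u c) ∧ (U c → c = 1) := by
    intro j
    induction j with
    | zero =>
      intro c hc
      rw [Subgroup.upperCentralSeries_zero, Subgroup.mem_bot] at hc
      subst hc
      exact ⟨fun u _ => Commute.one_right u, fun _ => rfl⟩
    | succ j ih =>
      intro c hc
      rw [Subgroup.mem_upperCentralSeries_succ_iff] at hc
      have h1 : ∀ u, U u → Commute u c := by
        intro u hu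
        have hd := ih _ (hc u)
        have hUd : U ⁅c, u⁆ :=
          hmul (c * u * c⁻¹) u⁻¹ (by
            have h2 : c * u * c⁻¹ = ⁅c, u⁆ * u := by simp [commutatorElement_def]
            rw [h2]
            exact ((hd.1 u hu).symm.mul_left (Commute.refl u)).inv_right) (hconj u hu c) (hinv u hu)
        exact (commutatorElement_eq_one_iff_commute.1 (hd.2 hUd)).symm
      refine ⟨h1, fun hUc => hcen c (Subgroup.mem_center_iff.2 fun g => ?_) hUc⟩
      have hd := ih _ (hc g)
      -- Here `g` is arbitrary; the factors `c` and `g * c⁻¹ * g⁻¹` both satisfy `U`, and they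
      -- commute because `⁅c, g⁆` lies one level lower.
      have hUd : U ⁅c, g⁆ := by
        have h2 : ⁅c, g⁆ = c * (g * c⁻¹ * g⁻¹) := by simp [commutatorElement_def, mul_assoc]
        have h3 : g * c⁻¹ * g⁻¹ = c⁻¹ * ⁅c, g⁆ := by simp [commutatorElement_def, mul_assoc]
        have h4 : Commute c (g * c⁻¹ * g⁻¹) := by
          rw [h3]
          exact (Commute.refl c).inv_right.mul_right (hd.1 c hUc)
        rw [h2]
        exact hmul _ _ h4 hUc (hconj _ (hinv c hUc) g)
      exact (commutatorElement_eq_one_iff_commute.1 (hd.2 hUd)).eq.symm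
  obtain ⟨j, hj⟩ := Group.IsNilpotent.nilpotent H
  exact (key j u (hj ▸ Subgroup.mem_top u)).2 hu

/-! ### Complex conjugation and real points -/

theorem commute_of_commute_exp {A : Type*} [NormedRing A] [NormedAlgebra ℂ A] [CompleteSpace A]
    {u X : A} (h : ∀ t : ℝ, Commute u (NormedSpace.exp ((t : ℂ) • X))) : Commute u X := by
  have h0 := hasDerivAt_exp_smul_const (𝕂 := ℂ) X 0
  have h1 := HasDerivAt.scomp (0 : ℝ) (g₁ := (fun s : ℂ => u * NormedSpace.exp (s • X)) -
    fun s : ℂ => NormedSpace.exp (s • X) * u) (h := fun t : ℝ => (t : ℂ))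
    (by simpa only [Complex.ofReal_zero] using (h0.const_mul u).sub (h0.mul_const u))
    Complex.ofRealCLM.hasDerivAt
  have h2 : ((fun s : ℂ => u * NormedSpace.exp (s • X)) -
      fun s : ℂ => NormedSpace.exp (s • X) * u) ∘ (fun t : ℝ => (t : ℂ)) = fun _ => 0 := by
    funext t
    exact sub_eq_zero.2 (h t).eq
  rw [h2] at h1
  have h3 := h1.unique (hasDerivAt_const _ _)
  exact sub_eq_zero.1 (by simpa using h3)

/-- Complex conjugation on `SL_n(ℂ)`. -/
noncomputable def conjSL : SLC n →* SLC n := Matrix.SpecialLinearGroup.map (starRingEnd ℂ)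

theorem coe_conjSL (g : SLC n) : (conjSL g : Matrix (Fin n) (Fin n) ℂ) =
    (g : Matrix (Fin n) (Fin n) ℂ).map (starRingEnd ℂ) := rfl

theorem mem_realPoints_iff {G : Subgroup (SLC n)} {g : SLC n} :
    g ∈ realPoints G ↔ g ∈ G ∧ conjSL g = g := by
  rw [realPoints, Subgroup.mem_inf]
  refine and_congr_right fun _ => ⟨?_, fun h => ?_⟩
  · rintro ⟨r, rfl⟩
    ext i j
    simp [conjSL]
  · have h1 : ∀ i j, ((g i j).re : ℂ) = g i j := by
      intro i j
      rw [← Complex.conj_eq_iff_re]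
      exact congrFun (congrFun (congrArg Subtype.val h) i) j
    have h2 : ((g : Matrix (Fin n) (Fin n) ℂ).map Complex.re).map Complex.ofRealHom =
        (g : Matrix (Fin n) (Fin n) ℂ) := by
      ext i j
      simpa using h1 i j
    have hdet : ((g : Matrix (Fin n) (Fin n) ℂ).map Complex.re).det = 1 := by
      apply Complex.ofRealHom.injective
      have h3 := Complex.ofRealHom.map_det ((g : Matrix (Fin n) (Fin n) ℂ).map Complex.re)
      rw [h3, RingHom.mapMatrix_apply, h2, g.2, map_one]
    exact ⟨⟨_, hdet⟩, Subtype.ext h2⟩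

theorem conjSL_mem {G : Subgroup (SLC n)} (hR : IsDefinedOverReal G) {g : SLC n} (hg : g ∈ G) :
    conjSL g ∈ G := by
  obtain ⟨S, hS⟩ := hR
  have hmem := fun g : SLC n => Set.ext_iff.1 hS g
  refine (hmem _).2 fun p hp => ?_
  have h1 := (hmem g).1 hg p hp
  have h2 : MvPolynomial.aeval (fun ij : Fin n × Fin n => starRingEnd ℂ (g ij.1 ij.2)) p =
      starRingEnd ℂ (MvPolynomial.aeval (fun ij : Fin n × Fin n => g ij.1 ij.2) p) := by
    have := MvPolynomial.comp_aeval_apply (fun ij : Fin n × Fin n => g ij.1 ij.2)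
      Complex.conjAe.toAlgHom p
    exact this.symm
  exact h2.trans (by rw [h1, map_zero])

theorem exp_smul_map_conj (X : Matrix (Fin n) (Fin n) ℂ) (t : ℂ) :
    NormedSpace.exp (t • X.map (starRingEnd ℂ)) =
      (NormedSpace.exp (starRingEnd ℂ t • X)).map (starRingEnd ℂ) := by
  have h1 : ∀ Y : Matrix (Fin n) (Fin n) ℂ, Y.map (starRingEnd ℂ) = Y.conjTranspose.transpose :=
    fun Y => rfl
  rw [h1 (NormedSpace.exp _), ← Matrix.exp_conjTranspose, ← Matrix.exp_transpose]
  congr 1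
  ext i j
  simp

theorem IsTangent.conj {G : Subgroup (SLC n)} (hR : IsDefinedOverReal G)
    {X : Matrix (Fin n) (Fin n) ℂ} (hX : IsTangent G X) : IsTangent G (X.map (starRingEnd ℂ)) := by
  intro t
  obtain ⟨w, hw, hwX⟩ := hX (starRingEnd ℂ t)
  exact ⟨conjSL w, conjSL_mem hR hw, by rw [coe_conjSL, hwX, exp_smul_map_conj]⟩

-- The matrix `X + X̄` is real and tangent to `G`, so its real one-parameter group consists of real
-- points; differentiate the commutation with `u` at `0`.
open scoped Matrix.Norms.Operator in
theorem commute_add_conj {G : Subgroup (SLC n)} (hG : IsZariskiClosed G) (hR : IsDefinedOverReal G)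
    {X : Matrix (Fin n) (Fin n) ℂ} (hX : IsTangent G X) {u : SLC n}
    (hu : ∀ g ∈ realPoints G, Commute u g) :
    Commute (u : Matrix (Fin n) (Fin n) ℂ) (X + X.map (starRingEnd ℂ)) := by
  have hY := hX.add hG (hX.conj hR)
  refine commute_of_commute_exp fun t => ?_
  obtain ⟨w, hw, hwY⟩ := hY t
  refine Eq.subst (motive := Commute (u : Matrix (Fin n) (Fin n) ℂ)) hwY ?_
  refine commute_coe_iff.2 (hu w (mem_realPoints_iff.2 ⟨hw, Subtype.ext ?_⟩))
  rw [coe_conjSL]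
  change _ = (w : Matrix (Fin n) (Fin n) ℂ)
  have h1 : (X + X.map (starRingEnd ℂ)).map (starRingEnd ℂ) = X + X.map (starRingEnd ℂ) := by
    ext i j
    simp [add_comm]
  rw [hwY]
  conv_rhs => rw [← h1, exp_smul_map_conj, Complex.conj_ofReal]

/-- A real element commuting with the real points commutes with all unipotent elements. -/
theorem commute_unipotent_of_commute_realPoints {G : Subgroup (SLC n)} (hG : IsZariskiClosed G)
    (hR : IsDefinedOverReal G) {u : SLC n} (hu : ∀ g ∈ realPoints G, Commute u g) {v : SLC n}
    (hvG : v ∈ G) (hv : IsUnipotentElement v) : Commute u v := by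
  obtain ⟨X, hX, -, hT⟩ := hv.exists_log hG hvG
  have h1 := commute_add_conj hG hR hT hu
  have h2 := commute_add_conj hG hR (hT.smul Complex.I) hu
  -- Real elements span the Lie algebra over `ℂ`: `X` is recovered from the sums of `X` and of `i X`
  -- with their conjugates.
  have h3 : X = (2⁻¹ : ℂ) • ((X + X.map (starRingEnd ℂ)) -
      Complex.I • (Complex.I • X + (Complex.I • X).map (starRingEnd ℂ))) := by
    ext i j
    simp only [Matrix.smul_apply, Matrix.sub_apply, Matrix.add_apply, Matrix.map_apply, smul_eq_mul,
      map_mul, Complex.conj_I]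
    linear_combination (2⁻¹ : ℂ) * (X i j - starRingEnd ℂ (X i j)) * Complex.I_mul_I
  have h4 : Commute (u : Matrix (Fin n) (Fin n) ℂ) X := by
    rw [h3]
    exact (h1.sub_right (h2.smul_right _)).smul_right _
  have h5 := hX 1
  rw [Nat.cast_one, one_smul, pow_one] at h5
  rw [← commute_coe_iff, ← h5]
  exact h4.exp_right

/-- Only central `u` need be treated, and these commute with all unipotents of `G`, including the
non-real ones. -/
theorem eq_one_of_isUnipotentElement {G N : Subgroup (SLC n)}
    (hG : IsZariskiClosed G) (hred : IsReductive G)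
    (hN : N = G ∨ (IsDefinedOverReal G ∧ N = realPoints G)) (hnil : Group.IsNilpotent N)
    {u : SLC n} (huN : u ∈ N) (hu : IsUnipotentElement u) : u = 1 := by
  have hNG : N ≤ G := by
    rcases hN with rfl | ⟨-, rfl⟩
    exacts [le_rfl, inf_le_left]
  have := eq_one_of_forall_center (H := N) (fun u => IsUnipotentElement (u : SLC n))
    (fun u hu g => hu.conj g) (fun u hu => hu.inv)
    (fun u v h hu hv => .mul (congrArg Subtype.val h.eq) hu hv) (fun u hu huU => ?_) ⟨u, huN⟩ hu
  · exact congrArg Subtype.val this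
  · have hc : ∀ g ∈ N, Commute (u : SLC n) g := fun g hg =>
      (congrArg Subtype.val (Subgroup.mem_center_iff.1 hu ⟨g, hg⟩)).symm
    refine Subtype.ext (eq_one_of_commute_unipotent hG hred (hNG u.2) huU fun v hv huv => ?_)
    rcases hN with rfl | ⟨hR, rfl⟩
    · exact hc v hv
    · exact commute_unipotent_of_commute_realPoints hG hR hc hv huv

/-! ### Jordan decomposition and semisimplicity -/

theorem isSemisimpleEnd_of_isSemisimple {V : Type} [AddCommGroup V] [Module ℂ V]
    [FiniteDimensional ℂ V] {f : Module.End ℂ V} (hf : f.IsSemisimple) : IsSemisimpleEnd f := by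
  rw [IsSemisimpleEnd, eq_top_iff, ← hf.iSup_eigenspace_eq_top]
  refine iSup_le fun μ w hw => ?_
  by_cases h0 : w = 0
  · simp [h0]
  · exact Submodule.subset_span ⟨μ, hw, h0⟩

theorem aeval_map_conj (A : Matrix (Fin n) (Fin n) ℂ) (p : Polynomial ℂ) :
    Polynomial.aeval (A.map (starRingEnd ℂ)) (p.map (starRingEnd ℂ)) =
      (Polynomial.aeval A p).map (starRingEnd ℂ) := by
  have h := Polynomial.hom_eval₂ p (algebraMap ℂ (Matrix (Fin n) (Fin n) ℂ))
    (starRingEnd ℂ).mapMatrix A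
  rw [Polynomial.aeval_def, Polynomial.eval₂_map, Polynomial.aeval_def]
  refine Eq.trans ?_ h.symm
  congr 1
  ext c i j
  by_cases hij : i = j <;> simp [Matrix.algebraMap_matrix_apply, hij]

/-- The conjugated minimal polynomial annihilates the conjugated matrix, and it stays squarefree
because separability survives field homomorphisms. -/
theorem isSemisimple_map_conj {A : Matrix (Fin n) (Fin n) ℂ}
    (hA : Module.End.IsSemisimple (Matrix.toLin' A)) :
    Module.End.IsSemisimple (Matrix.toLin' (A.map (starRingEnd ℂ))) := by
  have hae : ∀ (B : Matrix (Fin n) (Fin n) ℂ) (p : Polynomial ℂ),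
      Polynomial.aeval (Matrix.toLin' B) p = Matrix.toLin' (Polynomial.aeval B p) :=
    fun B p => Polynomial.aeval_algHom_apply
      (Matrix.toLinAlgEquiv' : _ ≃ₐ[ℂ] Module.End ℂ (Fin n → ℂ)) B p
  refine Module.End.isSemisimple_of_squarefree_aeval_eq_zero
    (p := (minpoly ℂ (Matrix.toLin' A)).map (starRingEnd ℂ)) ?_ ?_
  · exact ((PerfectField.separable_iff_squarefree.2 hA.minpoly_squarefree).map).squarefree
  · have h1 := minpoly.aeval ℂ (Matrix.toLin' A)
    rw [hae] at h1
    have h2 : Polynomial.aeval A (minpoly ℂ (Matrix.toLin' A)) = 0 := by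
      rwa [LinearEquiv.map_eq_zero_iff] at h1
    rw [hae, aeval_map_conj, h2]
    simp

theorem exists_jordan (A : Matrix (Fin n) (Fin n) ℂ) :
    ∃ S M : Matrix (Fin n) (Fin n) ℂ, Module.End.IsSemisimple (Matrix.toLin' S) ∧ IsNilpotent M ∧
      Commute M S ∧ A = M + S := by
  obtain ⟨m, hm, s, hs, hmn, hss, h⟩ := Module.End.exists_isNilpotent_isSemisimple (f := Matrix.toLin' A)
  have hc : Commute m s := Algebra.commute_of_mem_adjoin_singleton_of_commute hs
    (Algebra.commute_of_mem_adjoin_self hm).symm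
  refine ⟨LinearMap.toMatrix' s, LinearMap.toMatrix' m, by simpa using hss,
    hmn.map LinearMap.toMatrixAlgEquiv', hc.map LinearMap.toMatrixAlgEquiv', ?_⟩
  rw [← map_add, ← h, LinearMap.toMatrix'_toLin']

theorem jordan_unique {S M S' M' : Matrix (Fin n) (Fin n) ℂ}
    (hS : Module.End.IsSemisimple (Matrix.toLin' S)) (hM : IsNilpotent M) (hc : Commute M S)
    (hS' : Module.End.IsSemisimple (Matrix.toLin' S')) (hM' : IsNilpotent M') (hc' : Commute M' S')
    (h : M + S = M' + S') : S = S' := by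
  have := Module.End.isNilpotent_isSemisimple_unique
    (hM.map (Matrix.toLinAlgEquiv' : _ ≃ₐ[ℂ] Module.End ℂ (Fin n → ℂ))) hS
    (hM'.map (Matrix.toLinAlgEquiv' : _ ≃ₐ[ℂ] Module.End ℂ (Fin n → ℂ))) hS'
    (hc.map (Matrix.toLinAlgEquiv' : _ ≃ₐ[ℂ] Module.End ℂ (Fin n → ℂ)))
    (hc'.map (Matrix.toLinAlgEquiv' : _ ≃ₐ[ℂ] Module.End ℂ (Fin n → ℂ)))
    (by
      have := congrArg (Matrix.toLinAlgEquiv' : _ ≃ₐ[ℂ] Module.End ℂ (Fin n → ℂ)) h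
      rw [map_add, map_add] at this
      exact this)
  exact Matrix.toLin'.injective this.2

/-- The multiplicative Jordan decomposition in an algebraic group. -/
theorem exists_mul_jordan {G : Subgroup (SLC n)} (hG : IsZariskiClosed G) {g : SLC n} (hg : g ∈ G) :
    ∃ v ∈ G, IsUnipotentElement v ∧
      Module.End.IsSemisimple (Matrix.toLin' ((g * v⁻¹ : SLC n) : Matrix (Fin n) (Fin n) ℂ)) ∧ Commute g v := by
  obtain ⟨S, M, hS, hM, hc, h⟩ := exists_jordan (g : Matrix (Fin n) (Fin n) ℂ)
  have hgu : IsUnit (g : Matrix (Fin n) (Fin n) ℂ) := by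
    rw [Matrix.isUnit_iff_isUnit_det, g.2]
    exact isUnit_one
  have hcM : Commute M (g : Matrix (Fin n) (Fin n) ℂ) := by
    rw [h]
    exact (Commute.refl M).add_right hc
  have hSu : IsUnit S := by
    have h1 : S = g + -M := by
      rw [h]
      abel
    rw [h1]
    exact hM.neg.isUnit_add_left_of_commute hgu hcM.neg_left
  obtain ⟨s, rfl⟩ := hSu
  set V : Matrix (Fin n) (Fin n) ℂ := (s⁻¹ : (Matrix (Fin n) (Fin n) ℂ)ˣ) * g with hV
  have hMs : Commute M ((s⁻¹ : (Matrix (Fin n) (Fin n) ℂ)ˣ) : Matrix (Fin n) (Fin n) ℂ) :=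
    hc.units_inv_right
  have hV1 : V - 1 = (s⁻¹ : (Matrix (Fin n) (Fin n) ℂ)ˣ) * M := by
    rw [hV, h, mul_add, Units.inv_mul, add_sub_cancel_right]
  have hVn : IsNilpotent (V - 1) := by
    rw [hV1]
    exact hMs.symm.isNilpotent_mul_left hM
  have hgs : Commute (s : Matrix (Fin n) (Fin n) ℂ) g := by
    rw [h]
    exact hc.symm.add_right (Commute.refl _)
  have hsV : (s : Matrix (Fin n) (Fin n) ℂ) * V = g := by
    rw [hV, Units.mul_inv_cancel_left]
  have hcV : Commute (s : Matrix (Fin n) (Fin n) ℂ) V :=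
    (Commute.refl (s : Matrix (Fin n) (Fin n) ℂ)).units_inv_right.mul_right hgs
  obtain ⟨X, hX, hp⟩ := exists_log_of_unipotent hVn
  -- A polynomial vanishing on `G` vanishes at all `g ^ m = s ^ m * V ^ m`; taking exponent `0` for
  -- `s` and `1` for `V` gives `V ∈ G`.
  obtain ⟨v, hv, hvV⟩ := mem_of_forall_entryEval hG V fun f hf => by
    have := entryEval_pow_mul_exp_eq_zero (isSemisimpleEnd_of_isSemisimple hS) s.isUnit hX hp f
      (fun m => by
        rw [← hcV.mul_pow, hsV, ← Matrix.SpecialLinearGroup.coe_pow]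
        exact hf _ (pow_mem hg m)) 0 1
    have h1 := hX 1
    rw [Nat.cast_one, pow_one] at h1
    rwa [h1, pow_zero, one_mul] at this
  refine ⟨v, hv, by rwa [isUnipotentElement_iff, hvV], ?_, ?_⟩
  · have h2 : ((g * v⁻¹ : SLC n) : Matrix (Fin n) (Fin n) ℂ) = s := by
      have h3 : (v : Matrix (Fin n) (Fin n) ℂ) * ((v⁻¹ : SLC n) : Matrix (Fin n) (Fin n) ℂ) = 1 := by
        rw [← Matrix.SpecialLinearGroup.coe_mul, mul_inv_cancel, Matrix.SpecialLinearGroup.coe_one]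
      rw [Matrix.SpecialLinearGroup.coe_mul, ← hsV, ← hvV, mul_assoc, h3, mul_one]
    rwa [h2]
  · rw [← commute_coe_iff, hvV, ← hsV]
    exact hcV.mul_left (Commute.refl V)

/-- Conjugating `g = s * v` gives a second Jordan decomposition of the same matrix. Uniqueness is
applied in the additive form `s * (v - 1) + s`. -/
theorem conjSL_jordan {g v : SLC n} (hg : conjSL g = g) (hv : IsUnipotentElement v)
    (hs : Module.End.IsSemisimple (Matrix.toLin' ((g * v⁻¹ : SLC n) : Matrix (Fin n) (Fin n) ℂ)))
    (hc : Commute g v) : conjSL v = v := by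
  set s : SLC n := g * v⁻¹ with hsdef
  have hvs : Commute v s := hc.symm.mul_right (Commute.refl v).inv_right
  have hsv : s * v = g := by simp [hsdef]
  have hM : ∀ {s v : SLC n}, Commute v s → IsUnipotentElement v →
      IsNilpotent ((s : Matrix (Fin n) (Fin n) ℂ) * ((v : Matrix (Fin n) (Fin n) ℂ) - 1)) ∧
      Commute ((s : Matrix (Fin n) (Fin n) ℂ) * ((v : Matrix (Fin n) (Fin n) ℂ) - 1)) s := by
    intro s v h hv
    have h1 : Commute (s : Matrix (Fin n) (Fin n) ℂ) ((v : Matrix (Fin n) (Fin n) ℂ) - 1) :=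
      (commute_coe_iff.2 h.symm).sub_right (Commute.one_right _)
    exact ⟨h1.isNilpotent_mul_left (isUnipotentElement_iff.1 hv),
      (Commute.refl _).mul_left h1.symm⟩
  have hv' : IsUnipotentElement (conjSL v) := by
    rw [isUnipotentElement_iff] at hv ⊢
    have := hv.map (starRingEnd ℂ).mapMatrix
    rwa [map_sub, map_one] at this
  have hvs' : Commute (conjSL v) (conjSL s) := hvs.map conjSL
  have hsv' : conjSL s * conjSL v = g := by rw [← map_mul, hsv, hg]
  have hsum : ∀ s v : SLC n, (s : Matrix (Fin n) (Fin n) ℂ) * ((v : Matrix (Fin n) (Fin n) ℂ) - 1)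
      + s = ((s * v : SLC n) : Matrix (Fin n) (Fin n) ℂ) := by
    intro s v
    rw [mul_sub, mul_one, sub_add_cancel, Matrix.SpecialLinearGroup.coe_mul]
  have h1 : (s : Matrix (Fin n) (Fin n) ℂ) = conjSL s :=
    jordan_unique hs (hM hvs hv).1 (hM hvs hv).2 (isSemisimple_map_conj hs) (hM hvs' hv').1
      (hM hvs' hv').2 (by rw [hsum, hsum, hsv, hsv'])
  have h2 : s = conjSL s := Subtype.ext h1
  rw [← h2, ← hsv] at hsv'
  exact mul_left_cancel hsv'

theorem isSemisimple_of_mem {G N : Subgroup (SLC n)}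
    (hG : IsZariskiClosed G) (hred : IsReductive G)
    (hN : N = G ∨ (IsDefinedOverReal G ∧ N = realPoints G)) (hnil : Group.IsNilpotent N)
    {g : SLC n} (hg : g ∈ N) :
    Module.End.IsSemisimple (Matrix.toLin' (g : Matrix (Fin n) (Fin n) ℂ)) := by
  have hgG : g ∈ G := by
    rcases hN with rfl | ⟨-, rfl⟩
    exacts [hg, hg.1]
  obtain ⟨v, hvG, hv, hs, hc⟩ := exists_mul_jordan hG hgG
  have hvN : v ∈ N := by
    rcases hN with rfl | ⟨-, rfl⟩
    · exact hvG
    · exact mem_realPoints_iff.2 ⟨hvG, conjSL_jordan (mem_realPoints_iff.1 hg).2 hv hs hc⟩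
  have h1 := eq_one_of_isUnipotentElement hG hred hN hnil hvN hv
  rwa [h1, inv_one, mul_one] at hs

/-! ### Regular maps and connected sets -/

namespace IsRegularFun

theorem comp {φ : SLC n → Matrix (Fin n) (Fin n) ℂ} (hφ : ∀ i j, IsRegularFun fun g => φ g i j)
    (p : MvPolynomial (Fin n × Fin n) ℂ) : IsRegularFun fun g => entryEval (φ g) p := by
  induction p using MvPolynomial.induction_on with
  | C c => simpa using const c
  | add p q hp hq => simpa using hp.add hq
  | mul_X p ij hp => simpa using hp.mul (hφ ij.1 ij.2)

theorem inv_apply (i j : Fin n) : IsRegularFun fun g : SLC n => g⁻¹ i j := by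
  refine ⟨(Matrix.mvPolynomialX (Fin n) (Fin n) ℂ).adjugate i j, fun g => ?_⟩
  have h := AlgHom.map_adjugate (entryEval (g : Matrix (Fin n) (Fin n) ℂ))
    (Matrix.mvPolynomialX (Fin n) (Fin n) ℂ)
  rw [Matrix.mvPolynomialX_mapMatrix_aeval] at h
  exact (congrFun (congrFun h i) j).symm

theorem det {φ : SLC n → Matrix (Fin n) (Fin n) ℂ} (hφ : ∀ i j, IsRegularFun fun g => φ g i j) :
    IsRegularFun fun g => (φ g).det := by
  simpa only [entryEval_detPoly] using comp hφ (detPoly n)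

end IsRegularFun

/-- Morphisms of `SL_n(ℂ)` to itself. -/
def IsRegularMap (φ : SLC n → SLC n) : Prop := ∀ i j, IsRegularFun fun g => φ g i j

theorem IsRegularMap.comp {φ ψ : SLC n → SLC n} (hφ : IsRegularMap φ) (hψ : IsRegularMap ψ) :
    IsRegularMap (φ ∘ ψ) := fun i j => by
  obtain ⟨p, hp⟩ := hφ i j
  simpa only [Function.comp_apply, hp] using IsRegularFun.comp hψ p

theorem IsRegularMap.iterate {φ : SLC n → SLC n} (hφ : IsRegularMap φ) (k : ℕ) :
    IsRegularMap φ^[k] := by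
  induction k with
  | zero => exact IsRegularFun.apply
  | succ k ih => exact ih.comp hφ

theorem IsRegularMap.continuous {φ : SLC n → SLC n} (hφ : IsRegularMap φ) :
    @Continuous _ _ (zariskiTopology n) (zariskiTopology n) φ := by
  refine (@continuous_iff_isClosed _ _ (zariskiTopology n) (zariskiTopology n) _).2 fun Z hZ => ?_
  obtain ⟨S, rfl⟩ := isClosed_zariski_iff.1 hZ
  have : φ ⁻¹' {g : SLC n | ∀ p ∈ S, entryEval (g : Matrix (Fin n) (Fin n) ℂ) p = 0} =
      ⋂ p ∈ S, {g | entryEval (φ g : Matrix (Fin n) (Fin n) ℂ) p = 0} := by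
    ext t
    simp
  refine Eq.subst (motive := @IsClosed _ (zariskiTopology n)) this.symm ?_
  exact @isClosed_biInter _ _ (zariskiTopology n) _ _ fun p _ =>
    (IsRegularFun.comp hφ p).isClosed_setOf_eq_zero

theorem isRegularMap_mul_left (x : SLC n) : IsRegularMap fun y => x * y := fun i j => by
  simpa only [Matrix.SpecialLinearGroup.coe_mul] using IsRegularFun.matrix_mul
    (fun i j => .const (x i j)) IsRegularFun.apply i j

theorem isRegularMap_commutator (x : SLC n) : IsRegularMap fun y => x * y * x⁻¹ * y⁻¹ :=
  fun i j => by
    simp only [Matrix.SpecialLinearGroup.coe_mul]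
    exact .matrix_mul (.matrix_mul (.matrix_mul (fun i j => .const (x i j)) IsRegularFun.apply)
      (fun i j => .const (x⁻¹ i j))) IsRegularFun.inv_apply i j

/-- Regular functions with finitely many values are constant on connected sets. -/
theorem IsRegularFun.eq_of_isPreconnected {F : SLC n → ℂ} (hF : IsRegularFun F) {C : Set (SLC n)}
    (hC : @IsPreconnected _ (zariskiTopology n) C) (hfin : (F '' C).Finite) {x y : SLC n}
    (hx : x ∈ C) (hy : y ∈ C) : F x = F y := by
  by_contra hne
  have hcl : ∀ T : Set ℂ, T.Finite → @IsClosed _ (zariskiTopology n) (F ⁻¹' T) := by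
    intro T hT
    have : F ⁻¹' T = ⋃ c ∈ T, {g | F g - c = 0} := by
      ext g
      simp [sub_eq_zero]
    rw [this]
    exact @Set.Finite.isClosed_biUnion _ _ (zariskiTopology n) _ _ hT fun c _ =>
      (hF.sub (.const c)).isClosed_setOf_eq_zero
  obtain ⟨z, hz, hz1, hz2⟩ := (@isPreconnected_closed_iff _ (zariskiTopology n) C).1 hC
    (F ⁻¹' {F x}) (F ⁻¹' (F '' C \ {F x})) (hcl _ (Set.finite_singleton _))
    (hcl _ (hfin.subset Set.sdiff_subset))
    (fun z hz => by
      by_cases h : F z = F x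
      · exact Or.inl h
      · exact Or.inr ⟨⟨z, hz, rfl⟩, h⟩)
    ⟨x, hx, rfl⟩ ⟨y, hy, ⟨y, hy, rfl⟩, fun h => hne h.symm⟩
  exact hz2.2 hz1

/-! ### Eigenvalues and rigidity of families with root-of-unity spectrum -/

/-- `μ` is an eigenvalue of the matrix `A`. -/
def IsEig (A : Matrix (Fin n) (Fin n) ℂ) (μ : ℂ) : Prop := ∃ v, v ≠ 0 ∧ A.mulVec v = μ • v

theorem isEig_iff {A : Matrix (Fin n) (Fin n) ℂ} {μ : ℂ} :
    IsEig A μ ↔ Module.End.HasEigenvalue (Matrix.toLin' A) μ := by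
  constructor
  · rintro ⟨v, hv, h⟩
    exact Module.End.hasEigenvalue_of_hasEigenvector
      (x := v) ⟨Module.End.mem_eigenspace_iff.2 (by simpa using h), hv⟩
  · intro h
    obtain ⟨v, hv⟩ := h.exists_hasEigenvector
    exact ⟨v, hv.2, by simpa using hv.apply_eq_smul⟩

theorem isEig_iff_mem_roots {A : Matrix (Fin n) (Fin n) ℂ} {μ : ℂ} :
    IsEig A μ ↔ μ ∈ A.charpoly.roots := by
  rw [isEig_iff, Module.End.hasEigenvalue_iff_isRoot_charpoly, Matrix.charpoly_toLin',
    Polynomial.mem_roots A.charpoly_monic.ne_zero]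

theorem card_roots_charpoly (A : Matrix (Fin n) (Fin n) ℂ) : A.charpoly.roots.card = n := by
  rw [IsAlgClosed.card_roots_eq_natDegree, Matrix.charpoly_natDegree_eq_dim, Fintype.card_fin]

theorem IsEig.exists_common {A B : Matrix (Fin n) (Fin n) ℂ} (h : Commute A B) {μ : ℂ}
    (hμ : IsEig A μ) :
    ∃ (v : Fin n → ℂ) (ν : ℂ), v ≠ 0 ∧ A.mulVec v = μ • v ∧ B.mulVec v = ν • v := by
  have hc : Commute (Matrix.toLin' A : Module.End ℂ (Fin n → ℂ)) (Matrix.toLin' B) :=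
    h.map (Matrix.toLinAlgEquiv' : _ ≃ₐ[ℂ] Module.End ℂ (Fin n → ℂ))
  have hmaps := Module.End.mapsTo_genEigenspace_of_comm hc μ 1
  set E := Module.End.eigenspace (Matrix.toLin' A) μ with hE
  have hnt : Nontrivial E := Submodule.nontrivial_iff_ne_bot.2 (isEig_iff.1 hμ)
  obtain ⟨ν, hν⟩ := Module.End.exists_eigenvalue ((Matrix.toLin' B).restrict hmaps)
  obtain ⟨v, hv⟩ := hν.exists_hasEigenvector
  refine ⟨v, ν, fun h0 => hv.2 (Subtype.ext h0), ?_, ?_⟩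
  · simpa using Module.End.mem_eigenspace_iff.1 v.2
  · exact congrArg Subtype.val hv.apply_eq_smul

theorem IsEig.conj {h z : SLC n} {μ : ℂ}
    (hμ : IsEig ((h * z * h⁻¹ : SLC n) : Matrix (Fin n) (Fin n) ℂ) μ) :
    IsEig (z : Matrix (Fin n) (Fin n) ℂ) μ := by
  obtain ⟨v, hv, hv1⟩ := hμ
  have key : ((h⁻¹ : SLC n) : Matrix (Fin n) (Fin n) ℂ) *
      ((h * z * h⁻¹ : SLC n) : Matrix (Fin n) (Fin n) ℂ) =
      (z : Matrix (Fin n) (Fin n) ℂ) * ((h⁻¹ : SLC n) : Matrix (Fin n) (Fin n) ℂ) := by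
    rw [← Matrix.SpecialLinearGroup.coe_mul, ← Matrix.SpecialLinearGroup.coe_mul]
    exact congrArg Subtype.val (by simp [mul_assoc] : h⁻¹ * (h * z * h⁻¹) = z * h⁻¹)
  refine ⟨((h⁻¹ : SLC n) : Matrix (Fin n) (Fin n) ℂ).mulVec v, fun h0 => hv ?_, ?_⟩
  · have h2 := congrArg (h : Matrix (Fin n) (Fin n) ℂ).mulVec h0
    rwa [Matrix.mulVec_mulVec, ← Matrix.SpecialLinearGroup.coe_mul, mul_inv_cancel,
      Matrix.SpecialLinearGroup.coe_one, Matrix.one_mulVec, Matrix.mulVec_zero] at h2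
  · rw [Matrix.mulVec_mulVec, ← key, ← Matrix.mulVec_mulVec, hv1, Matrix.mulVec_smul]

theorem IsEig.ne_zero {g : SLC n} {μ : ℂ} (hμ : IsEig (g : Matrix (Fin n) (Fin n) ℂ) μ) : μ ≠ 0 := by
  rintro rfl
  obtain ⟨v, hv, h⟩ := hμ
  refine hv ?_
  have h2 := congrArg ((g⁻¹ : SLC n) : Matrix (Fin n) (Fin n) ℂ).mulVec h
  rwa [Matrix.mulVec_mulVec, ← Matrix.SpecialLinearGroup.coe_mul, inv_mul_cancel,
    Matrix.SpecialLinearGroup.coe_one, Matrix.one_mulVec, zero_smul, Matrix.mulVec_zero] at h2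

theorem mulVec_pow_eq {A : Matrix (Fin n) (Fin n) ℂ} {v : Fin n → ℂ} {μ : ℂ}
    (h : A.mulVec v = μ • v) (k : ℕ) : (A ^ k).mulVec v = μ ^ k • v := by
  induction k with
  | zero => simp
  | succ k ih =>
    rw [pow_succ, ← Matrix.mulVec_mulVec, h, Matrix.mulVec_smul, ih, smul_smul, pow_succ, mul_comm]

/-- If `w` commutes with `z` and all `w ^ m * z` are conjugate to `z`, then the eigenvalues of `w`
are roots of unity of bounded order. -/
theorem pow_factorial_eq_one_of_isEig {w z : SLC n} (hc : Commute w z)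
    (h : ∀ m : ℕ, ∃ h : SLC n, w ^ m * z = h * z * h⁻¹) {γ : ℂ}
    (hγ : IsEig (w : Matrix (Fin n) (Fin n) ℂ) γ) : γ ^ n.factorial = 1 := by
  obtain ⟨v, l, hv, h1, h2⟩ := hγ.exists_common (commute_coe_iff.2 hc)
  have hl : l ≠ 0 := IsEig.ne_zero ⟨v, hv, h2⟩
  have hγ0 : γ ≠ 0 := hγ.ne_zero
  -- On a common eigenvector, `w ^ m * z` has eigenvalue `γ ^ m * l`, which conjugacy turns into an
  -- eigenvalue of `z`.
  have hmem : ∀ m : ℕ, γ ^ m * l ∈ (z : Matrix (Fin n) (Fin n) ℂ).charpoly.roots.toFinset := by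
    intro m
    rw [Multiset.mem_toFinset, ← isEig_iff_mem_roots]
    obtain ⟨x, hx⟩ := h m
    refine IsEig.conj (h := x) ?_
    rw [← hx]
    refine ⟨v, hv, ?_⟩
    rw [Matrix.SpecialLinearGroup.coe_mul, ← Matrix.mulVec_mulVec, h2, Matrix.mulVec_smul,
      Matrix.SpecialLinearGroup.coe_pow, mulVec_pow_eq h1, smul_smul, mul_comm]
  -- There are `n + 1` exponents but at most `n` eigenvalues, so two exponents coincide; their
  -- difference is at most `n` and divides `n!`.
  obtain ⟨a, ha, b, hb, hab, heq⟩ := Finset.exists_ne_map_eq_of_card_lt_of_maps_to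
    (s := Finset.range (n + 1)) (t := (z : Matrix (Fin n) (Fin n) ℂ).charpoly.roots.toFinset)
    (f := fun m => γ ^ m * l) (by
      rw [Finset.card_range, Nat.lt_succ_iff]
      exact (Multiset.toFinset_card_le _).trans (card_roots_charpoly _).le) (fun m _ => hmem m)
  have heq' := mul_right_cancel₀ hl heq
  rw [Finset.mem_range] at ha hb
  have aux : ∀ a b : ℕ, a < b → b < n + 1 → γ ^ a = γ ^ b → γ ^ n.factorial = 1 := by
    intro a b hab hb h
    have h3 : γ ^ (b - a) = 1 := by
      have h4 : γ ^ a * γ ^ (b - a) = γ ^ a * 1 := by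
        rw [← pow_add, Nat.add_sub_cancel' hab.le, mul_one, h]
      exact mul_left_cancel₀ (pow_ne_zero a hγ0) h4
    obtain ⟨q, hq⟩ := Nat.dvd_factorial (Nat.sub_pos_of_lt hab) (show b - a ≤ n by omega)
    rw [hq, pow_mul, h3, one_pow]
  rcases lt_or_gt_of_ne hab with hlt | hlt
  · exact aux a b hlt hb heq'
  · exact aux b a hlt ha heq'.symm

/-- The root multiset is contained in `n` copies of the set of `k`-th roots of unity, which has
finitely many submultisets. -/
theorem finite_charpoly_eval (k : ℕ) (hk : 0 < k) (ζ : ℂ) :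
    {x : ℂ | ∃ A : Matrix (Fin n) (Fin n) ℂ, (∀ μ, IsEig A μ → μ ^ k = 1) ∧
      x = A.charpoly.eval ζ}.Finite := by
  classical
  set R : Finset ℂ := (Polynomial.nthRoots k (1 : ℂ)).toFinset with hR
  refine (((n • R.val).powerset.map fun m => (m.map fun μ => ζ - μ).prod).toFinset.finite_toSet).subset ?_
  rintro _ ⟨A, hA, rfl⟩
  rw [Finset.mem_coe, Multiset.mem_toFinset, Multiset.mem_map]
  refine ⟨A.charpoly.roots, ?_, ?_⟩
  · rw [Multiset.mem_powerset, Multiset.le_iff_count]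
    intro μ
    by_cases hμ : μ ∈ A.charpoly.roots
    · have h1 : μ ∈ R := by
        rw [hR, Multiset.mem_toFinset, Polynomial.mem_nthRoots hk]
        exact hA μ (isEig_iff_mem_roots.2 hμ)
      have h2 : Multiset.count μ R.val = 1 := Multiset.count_eq_one_of_mem R.nodup h1
      rw [Multiset.count_nsmul, h2, mul_one]
      exact (Multiset.count_le_card _ _).trans (card_roots_charpoly A).le
    · rw [Multiset.count_eq_zero_of_notMem hμ]
      exact Nat.zero_le _
  · have h := (IsAlgClosed.splits A.charpoly).eq_prod_roots_of_monic A.charpoly_monic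
    conv_rhs => rw [h]
    rw [Polynomial.eval_multiset_prod, Multiset.map_map]
    simp

theorem IsSemisimpleElement.eq_one {w : SLC n} (hw : IsSemisimpleElement w)
    (h : ∀ μ, IsEig (w : Matrix (Fin n) (Fin n) ℂ) μ → μ = 1) : w = 1 := by
  have h1 : Matrix.toLin' (w : Matrix (Fin n) (Fin n) ℂ) = LinearMap.id := by
    refine LinearMap.ext_on (s := {v | ∃ μ, Module.End.HasEigenvector
      (Matrix.toLin' (w : Matrix (Fin n) (Fin n) ℂ)) μ v}) hw ?_
    rintro v ⟨μ, hv⟩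
    have h2 := h μ (isEig_iff.2 (Module.End.hasEigenvalue_of_hasEigenvector hv))
    rw [hv.apply_eq_smul, h2, one_smul, LinearMap.id_apply]
  refine Subtype.ext (Matrix.toLin'.injective ?_)
  rw [h1]
  exact Matrix.toLin'_one.symm

/-- A morphism sending a connected set containing `1` to semisimple elements whose eigenvalues are
`k`-th roots of unity is trivial, if it fixes `1`. -/
theorem IsRegularMap.eq_one_of_isPreconnected {φ : SLC n → SLC n} (hφ : IsRegularMap φ)
    (h1 : φ 1 = 1) {C : Set (SLC n)} (hC : @IsPreconnected _ (zariskiTopology n) C) (hC1 : 1 ∈ C)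
    {k : ℕ} (hk : 0 < k) (hss : ∀ y ∈ C, IsSemisimpleElement (φ y))
    (heig : ∀ y ∈ C, ∀ μ, IsEig (φ y : Matrix (Fin n) (Fin n) ℂ) μ → μ ^ k = 1) {y : SLC n}
    (hy : y ∈ C) : φ y = 1 := by
  refine (hss y hy).eq_one fun ζ hζ => ?_
  by_contra hne
  -- Evaluated at the fixed `ζ`, the characteristic polynomial takes finitely many values on `C`,
  -- hence is constant there. It is `0` at `y` but `(ζ - 1) ^ n ≠ 0` at `1`.
  have hreg : IsRegularFun fun g => (φ g : Matrix (Fin n) (Fin n) ℂ).charpoly.eval ζ := by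
    simp only [Matrix.eval_charpoly]
    exact .det fun i j => by
      simp only [Matrix.sub_apply]
      exact (IsRegularFun.const _).sub (hφ i j)
  have heq := hreg.eq_of_isPreconnected hC ((finite_charpoly_eval k hk ζ).subset (by
    rintro _ ⟨g, hg, rfl⟩
    exact ⟨_, heig g hg, rfl⟩)) hy hC1
  rw [isEig_iff_mem_roots, Polynomial.mem_roots (Matrix.charpoly_monic _).ne_zero,
    Polynomial.IsRoot.def] at hζ
  rw [hζ, h1, Matrix.SpecialLinearGroup.coe_one, Matrix.charpoly_one] at heq
  refine pow_ne_zero (Fintype.card (Fin n)) (sub_ne_zero.2 hne) ?_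
  simpa using heq.symm

/-! ### Centrality of the identity component -/

variable {N : Subgroup (SLC n)}

/-- The upper central series of `N`, as subgroups of `SL_n(ℂ)`. -/
def upperCentral (N : Subgroup (SLC n)) (j : ℕ) : Subgroup (SLC n) :=
  (Subgroup.upperCentralSeries N j).map N.subtype

theorem commutator_mem_upperCentral {j : ℕ} {x y : SLC n} (hx : x ∈ upperCentral N (j + 1))
    (hy : y ∈ N) : x * y * x⁻¹ * y⁻¹ ∈ upperCentral N j := by
  obtain ⟨a, ha, rfl⟩ := hx
  exact ⟨_, Subgroup.mem_upperCentralSeries_succ_iff.1 ha ⟨y, hy⟩, rfl⟩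

theorem commutator_mem_upperCentral' {j : ℕ} {x y : SLC n} (hx : x ∈ upperCentral N (j + 1))
    (hy : y ∈ N) : y * x * y⁻¹ * x⁻¹ ∈ upperCentral N j := by
  simpa [mul_assoc] using inv_mem (commutator_mem_upperCentral hx hy)

theorem upperCentral_zero : upperCentral N 0 = ⊥ := by
  simp [upperCentral]

theorem upperCentral_le (j : ℕ) : upperCentral N j ≤ N := by
  rintro _ ⟨x, -, rfl⟩
  exact x.2

theorem one_mem_identityComponent : (1 : SLC n) ∈ identityComponent N :=
  @mem_connectedComponentIn _ (zariskiTopology n) _ _ (one_mem N)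

theorem identityComponent_subset : identityComponent N ⊆ (N : Set (SLC n)) :=
  @connectedComponentIn_subset _ (zariskiTopology n) _ _

theorem isPreconnected_identityComponent :
    @IsPreconnected _ (zariskiTopology n) (identityComponent N) :=
  @isPreconnected_connectedComponentIn _ (zariskiTopology n) _ _

theorem subset_identityComponent {P : Set (SLC n)} (hP : @IsPreconnected _ (zariskiTopology n) P)
    (h1 : (1 : SLC n) ∈ P) (hPN : P ⊆ (N : Set (SLC n))) : P ⊆ identityComponent N :=
  @IsPreconnected.subset_connectedComponentIn _ (zariskiTopology n) _ _ _ hP h1 hPN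

theorem commutator_mem_identityComponent {x y : SLC n} (hx : x ∈ N)
    (hy : y ∈ identityComponent N) : x * y * x⁻¹ * y⁻¹ ∈ identityComponent N := by
  have hcont := (isRegularMap_commutator x).continuous
  refine subset_identityComponent (P := (fun y => x * y * x⁻¹ * y⁻¹) '' identityComponent N)
    (@IsPreconnected.image _ _ (zariskiTopology n) (zariskiTopology n) _
      isPreconnected_identityComponent _
      (@Continuous.continuousOn _ _ (zariskiTopology n) (zariskiTopology n) _ _ hcont))
    ⟨1, one_mem_identityComponent, by simp⟩ ?_ ⟨y, hy, rfl⟩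
  rintro _ ⟨z, hz, rfl⟩
  have hzN : z ∈ N := identityComponent_subset hz
  exact mul_mem (mul_mem (mul_mem hx hzN) (inv_mem hx)) (inv_mem hzN)

/-- One step of the descent along the upper central series. -/
theorem commute_of_commute_upperCentral (hss : ∀ g ∈ N, IsSemisimpleElement g) {j : ℕ}
    (ih : ∀ w ∈ upperCentral N j, ∀ y ∈ identityComponent N, Commute w y) {x : SLC n}
    (hx : x ∈ upperCentral N (j + 1)) {y : SLC n} (hy : y ∈ identityComponent N) : Commute x y := by
  set c : SLC n → SLC n := fun y => x * y * x⁻¹ * y⁻¹ with hc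
  have hxN : x ∈ N := upperCentral_le _ hx
  have hcreg : IsRegularMap c := isRegularMap_commutator x
  have hC : ∀ k, ∀ y ∈ identityComponent N, c^[k] y ∈ identityComponent N := by
    intro k
    induction k with
    | zero => exact fun y hy => hy
    | succ k ihk =>
      intro y hy
      rw [Function.iterate_succ_apply']
      exact commutator_mem_identityComponent hxN (ihk y hy)
  -- Triviality of an iterate of `c` on the identity component descends to the preceding one, down
  -- to `c` itself.
  have hdesc : ∀ k, (∀ y ∈ identityComponent N, c^[k + 1] y = 1) →
      ∀ y ∈ identityComponent N, c y = 1 := by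
    intro k
    induction k with
    | zero => exact fun h => h
    | succ k ihk =>
      intro h
      refine ihk fun y hy => ?_
      have hc1 : c 1 = 1 := by simp [hc]
      refine (hcreg.iterate (k + 1)).eq_one_of_isPreconnected (Function.iterate_fixed hc1 _)
        isPreconnected_identityComponent one_mem_identityComponent n.factorial_pos
        (fun y hy => hss _ (identityComponent_subset (hC _ y hy))) (fun y hy γ hγ => ?_) hy
      set z := c^[k] y with hz
      have hzC : z ∈ identityComponent N := hC k y hy
      have hw : c^[k + 1] y = c z := by rw [Function.iterate_succ_apply']
      rw [hw] at hγ
      have hxw : Commute x (c z) := by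
        have h2 := h y hy
        rw [Function.iterate_succ_apply', hw] at h2
        have h3 : x * c z * x⁻¹ * (c z)⁻¹ = 1 := h2
        rw [mul_inv_eq_one, mul_inv_eq_iff_eq_mul] at h3
        exact h3
      have hwz : Commute (c z) z :=
        ih _ (commutator_mem_upperCentral hx (identityComponent_subset hzC)) z hzC
      refine pow_factorial_eq_one_of_isEig hwz (fun m => ⟨x ^ m, ?_⟩) hγ
      induction m with
      | zero => simp
      | succ m ihm =>
        -- As `x` commutes with `c z`, conjugating repeatedly by `x` multiplies `z` by successive
        -- powers of `c z`.
        have h4 : c z * z = x * z * x⁻¹ := by simp [hc]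
        calc c z ^ (m + 1) * z = c z ^ m * (c z * z) := by rw [pow_succ, mul_assoc]
          _ = c z ^ m * x * z * x⁻¹ := by rw [h4]; simp only [mul_assoc]
          _ = x * (c z ^ m * z) * x⁻¹ := by rw [← (hxw.pow_right m).eq]; simp only [mul_assoc]
          _ = x ^ (m + 1) * z * (x ^ (m + 1))⁻¹ := by
            rw [ihm, pow_succ' x m, mul_inv_rev]
            simp only [mul_assoc]
  -- Each application of `c` lowers the level by one, so `j + 1` applications reach the trivial
  -- group.
  have hnil : ∀ i, i ≤ j → ∀ y ∈ N, c^[i + 1] y ∈ upperCentral N (j - i) := by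
    intro i
    induction i with
    | zero => exact fun _ y hy => commutator_mem_upperCentral hx hy
    | succ i ihi =>
      intro hi y hy
      rw [Function.iterate_succ_apply']
      have h5 := ihi (by omega) y hy
      rw [show j - i = (j - (i + 1)) + 1 by omega] at h5
      exact commutator_mem_upperCentral' h5 hxN
  have h6 : c y = 1 := by
    refine hdesc j (fun y hy => ?_) y hy
    have h7 := hnil j le_rfl y (identityComponent_subset hy)
    rwa [Nat.sub_self, upperCentral_zero, Subgroup.mem_bot] at h7
  have h8 : x * y * x⁻¹ * y⁻¹ = 1 := h6
  rwa [mul_inv_eq_one, mul_inv_eq_iff_eq_mul] at h8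

theorem identityComponent_subset_center (hnil : Group.IsNilpotent N)
    (hss : ∀ g ∈ N, IsSemisimpleElement g) :
    identityComponent N ⊆ ((Subgroup.center N).map N.subtype : Set (SLC n)) := by
  have key : ∀ j, ∀ w ∈ upperCentral N j, ∀ y ∈ identityComponent N, Commute w y := by
    intro j
    induction j with
    | zero =>
      intro w hw y _
      rw [upperCentral_zero, Subgroup.mem_bot] at hw
      exact hw ▸ Commute.one_left y
    | succ j ih => exact fun x hx y hy => commute_of_commute_upperCentral hss ih hx hy
  obtain ⟨j, hj⟩ := Group.IsNilpotent.nilpotent N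
  intro y hy
  refine ⟨⟨y, identityComponent_subset hy⟩, Subgroup.mem_center_iff.2 fun g => Subtype.ext ?_, rfl⟩
  exact (key j g ⟨g, hj ▸ Subgroup.mem_top g, rfl⟩ y hy).eq

/-! ### Noetherianity and the index of the centre -/

theorem noetherianSpace_zariski : @TopologicalSpace.NoetherianSpace _ (zariskiTopology n) := by
  let I : Set (SLC n) → Ideal (MvPolynomial (Fin n × Fin n) ℂ) := fun Z =>
    ⨅ g ∈ Z, RingHom.ker (entryEval (g : Matrix (Fin n) (Fin n) ℂ))
  have hI : ∀ Z p, p ∈ I Z ↔ ∀ g ∈ Z, entryEval (g : Matrix (Fin n) (Fin n) ℂ) p = 0 := by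
    intro Z p
    simp [I, Submodule.mem_iInf, RingHom.mem_ker]
  let τ : TopologicalSpace (SLC n) := zariskiTopology n
  refine ((TopologicalSpace.noetherianSpace_TFAE (SLC n)).out 0 1).2 ?_
  -- Strictly shrinking closed sets have strictly growing vanishing ideals in a Noetherian
  -- polynomial ring.
  refine ⟨Subrelation.wf (r := InvImage (fun J K => J > K)
    (fun Z : TopologicalSpace.Closeds (SLC n) => I Z.1)) (fun {Z W} hZW => ?_)
    (InvImage.wf _ (wellFounded_gt (α := Ideal (MvPolynomial (Fin n × Fin n) ℂ))))⟩
  have hle : Z.1 ⊆ W.1 := hZW.le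
  refine lt_of_le_not_ge (fun p hp => (hI _ _).2 fun g hg => (hI _ _).1 hp g (hle hg)) fun h => ?_
  refine hZW.not_ge fun g hg => ?_
  obtain ⟨S, hS⟩ := isClosed_zariski_iff.1 Z.2
  have hmem := fun g : SLC n => Set.ext_iff.1 hS g
  refine (hmem g).2 fun p hp => ?_
  exact (hI _ _).1 (h ((hI _ _).2 fun g hg => (hmem g).1 hg p hp)) g hg

/-- Two elements of one irreducible component of `N` differ by an element of `N°`, which is central.
So cosets of the centre inject into the finite set of irreducible components; this needs only the
subspace topology and covers real points too. -/
theorem finiteIndex_center (hC : identityComponent N ⊆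
    ((Subgroup.center N).map N.subtype : Set (SLC n))) : (Subgroup.center N).FiniteIndex := by
  let τ : TopologicalSpace N := @instTopologicalSpaceSubtype _ (· ∈ N) (zariskiTopology n)
  have hτ : @Continuous _ _ τ (zariskiTopology n) (Subtype.val : N → SLC n) :=
    @continuous_subtype_val _ (zariskiTopology n) _
  have hnoeth : @TopologicalSpace.NoetherianSpace _ τ :=
    @Topology.IsInducing.noetherianSpace _ _ (zariskiTopology n) τ noetherianSpace_zariski _
      (@Topology.IsInducing.mk _ _ τ (zariskiTopology n) _ rfl)
  have hfin : Finite (@irreducibleComponents N τ) :=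
    (@TopologicalSpace.NoetherianSpace.finite_irreducibleComponents N τ hnoeth).to_subtype
  have : Finite (N ⧸ Subgroup.center N) := by
    refine Finite.of_injective (β := @irreducibleComponents N τ) (fun q =>
      ⟨@irreducibleComponent N τ q.out,
        @irreducibleComponent_mem_irreducibleComponents N τ q.out⟩) fun q r hqr => ?_
    have hqr' : @irreducibleComponent N τ q.out = @irreducibleComponent N τ r.out :=
      congrArg Subtype.val hqr
    rw [← q.out_eq', ← r.out_eq']
    refine QuotientGroup.eq.2 ?_
    set T := @irreducibleComponent N τ q.out
    have hT : @IsPreconnected _ (zariskiTopology n) (Subtype.val '' T) :=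
      @IsPreconnected.image _ _ τ (zariskiTopology n) _
        (@IsPreirreducible.isPreconnected _ τ _
          (@isIrreducible_irreducibleComponent _ τ _).isPreirreducible) _
        (@Continuous.continuousOn _ _ τ (zariskiTopology n) _ _ hτ)
    have hP := @IsPreconnected.image _ _ (zariskiTopology n) (zariskiTopology n) _ hT _
      (@Continuous.continuousOn _ _ (zariskiTopology n) (zariskiTopology n) _ _
        (isRegularMap_mul_left ((q.out : N) : SLC n)⁻¹).continuous)
    have hsub := subset_identityComponent (N := N) hP
      ⟨_, ⟨_, @mem_irreducibleComponent _ τ _, rfl⟩, by simp⟩ (by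
        rintro _ ⟨_, ⟨x, -, rfl⟩, rfl⟩
        exact mul_mem (inv_mem q.out.2) x.2)
    have hr : r.out ∈ T := hqr' ▸ @mem_irreducibleComponent _ τ _
    obtain ⟨x, hx, hxe⟩ := hC (hsub ⟨_, ⟨_, hr, rfl⟩, rfl⟩)
    have : x = q.out⁻¹ * r.out := Subtype.ext hxe
    exact this ▸ hx
  exact Subgroup.finiteIndex_of_finite_quotient

/-! ### Unit eigenvalues and the maximal compact subgroup -/

/-- All eigenvalues of `g` lie on the unit circle. -/
def HasUnitEigs (g : SLC n) : Prop := ∀ μ, IsEig (g : Matrix (Fin n) (Fin n) ℂ) μ → ‖μ‖ = 1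

namespace HasUnitEigs

theorem one : HasUnitEigs (1 : SLC n) := by
  rintro μ ⟨v, hv, h⟩
  rw [Matrix.SpecialLinearGroup.coe_one, Matrix.one_mulVec] at h
  have h1 : (1 - μ) • v = 0 := by rw [sub_smul, one_smul, ← h, sub_self]
  rcases smul_eq_zero.1 h1 with h2 | h2
  · rw [← sub_eq_zero.1 h2, norm_one]
  · exact absurd h2 hv

theorem mulVec_inv {g : SLC n} {v : Fin n → ℂ} {μ : ℂ} (hμ : μ ≠ 0)
    (h : (g : Matrix (Fin n) (Fin n) ℂ).mulVec v = μ • v) :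
    ((g⁻¹ : SLC n) : Matrix (Fin n) (Fin n) ℂ).mulVec v = μ⁻¹ • v := by
  have h1 := congrArg ((g⁻¹ : SLC n) : Matrix (Fin n) (Fin n) ℂ).mulVec h
  rw [Matrix.mulVec_mulVec, ← Matrix.SpecialLinearGroup.coe_mul, inv_mul_cancel,
    Matrix.SpecialLinearGroup.coe_one, Matrix.one_mulVec, Matrix.mulVec_smul] at h1
  rw [eq_inv_smul_iff₀ hμ, ← h1]

theorem inv {g : SLC n} (hg : HasUnitEigs g) : HasUnitEigs g⁻¹ := by
  intro μ hμ
  obtain ⟨v, hv, h⟩ := id hμ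
  have h1 := hg μ⁻¹ ⟨v, hv, by simpa using mulVec_inv hμ.ne_zero h⟩
  rwa [norm_inv, inv_eq_one] at h1

theorem mul_of_commute {g h : SLC n} (hc : Commute g h) (hg : HasUnitEigs g) (hh : HasUnitEigs h) :
    HasUnitEigs (g * h) := by
  intro μ hμ
  have hc' : Commute (g * h) g := (Commute.refl g).mul_left hc.symm
  obtain ⟨v, α, hv, h1, h2⟩ := hμ.exists_common (commute_coe_iff.2 hc')
  have hα : IsEig (g : Matrix (Fin n) (Fin n) ℂ) α := ⟨v, hv, h2⟩
  have h3 : (h : Matrix (Fin n) (Fin n) ℂ).mulVec v = (α⁻¹ * μ) • v := by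
    have h4 := congrArg ((g⁻¹ : SLC n) : Matrix (Fin n) (Fin n) ℂ).mulVec h1
    rw [Matrix.mulVec_mulVec, ← Matrix.SpecialLinearGroup.coe_mul, inv_mul_cancel_left,
      Matrix.mulVec_smul, mulVec_inv hα.ne_zero h2, smul_smul, mul_comm] at h4
    exact h4
  have h5 := hh _ ⟨v, hv, h3⟩
  rwa [norm_mul, norm_inv, hg α hα, inv_one, one_mul] at h5

theorem pow {g : SLC n} (hg : HasUnitEigs g) (k : ℕ) : HasUnitEigs (g ^ k) := by
  induction k with
  | zero => simpa using one
  | succ k ih => exact pow_succ g k ▸ ih.mul_of_commute ((Commute.refl g).pow_left k) hg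

theorem of_pow {g : SLC n} {k : ℕ} (hk : k ≠ 0) (hg : HasUnitEigs (g ^ k)) : HasUnitEigs g := by
  rintro μ ⟨v, hv, h⟩
  have h1 := hg (μ ^ k) ⟨v, hv, by
    rw [Matrix.SpecialLinearGroup.coe_pow, mulVec_pow_eq h]⟩
  rwa [norm_pow, pow_eq_one_iff_of_nonneg (norm_nonneg _) hk] at h1

/-- An eigenvalue of modulus above `1` would make the powers of `h` unbounded on its eigenvector. -/
theorem norm_le_one_of_isCompact {H : Subgroup (SLC n)} (hH : IsCompact (H : Set (SLC n)))
    {h : SLC n} (hh : h ∈ H) {μ : ℂ} (hμ : IsEig (h : Matrix (Fin n) (Fin n) ℂ) μ) : ‖μ‖ ≤ 1 := by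
  obtain ⟨v, hv, hv1⟩ := hμ
  obtain ⟨i, hi⟩ := Function.ne_iff.1 hv
  have hcont : Continuous fun g : SLC n => (g : Matrix (Fin n) (Fin n) ℂ).mulVec v i := by
    simp only [Matrix.mulVec, dotProduct]
    fun_prop
  obtain ⟨B, hB⟩ := hH.exists_bound_of_continuousOn hcont.continuousOn
  by_contra! hlt
  obtain ⟨m, hm⟩ := pow_unbounded_of_one_lt (B / ‖v i‖) hlt
  have h1 := hB (h ^ m) (pow_mem hh m)
  rw [Matrix.SpecialLinearGroup.coe_pow, mulVec_pow_eq hv1, Pi.smul_apply, smul_eq_mul, norm_mul,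
    norm_pow] at h1
  rw [div_lt_iff₀ (norm_pos_iff.2 hi)] at hm
  linarith

theorem of_isCompact {H : Subgroup (SLC n)} (hH : IsCompact (H : Set (SLC n))) {h : SLC n}
    (hh : h ∈ H) : HasUnitEigs h := by
  intro μ hμ
  refine le_antisymm (norm_le_one_of_isCompact hH hh hμ) ?_
  obtain ⟨v, hv, hv1⟩ := id hμ
  have h1 := norm_le_one_of_isCompact hH (inv_mem hh) ⟨v, hv, mulVec_inv hμ.ne_zero hv1⟩
  rw [norm_inv] at h1
  exact (inv_le_one₀ (norm_pos_iff.2 hμ.ne_zero)).1 h1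

end HasUnitEigs

/-- The elements of a centre-by-finite group `N` with all eigenvalues on the unit circle. -/
def unitEigsSubgroup (N : Subgroup (SLC n)) (hfi : (Subgroup.center N).FiniteIndex) :
    Subgroup (SLC n) where
  carrier := {g | g ∈ N ∧ HasUnitEigs g}
  one_mem' := ⟨one_mem N, .one⟩
  mul_mem' := by
    rintro a b ⟨haN, ha⟩ ⟨hbN, hb⟩
    refine ⟨mul_mem haN hbN, .of_pow (Subgroup.FiniteIndex.index_ne_zero (H := Subgroup.center N)) ?_⟩
    -- The transfer to the centre is `g ↦ g ^ index`, so `(a * b) ^ index` is a product of central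
    -- powers, although `a` and `b` need not commute.
    have h1 := congrArg (fun x : Subgroup.center N => ((x : N) : SLC n))
      (map_mul (MonoidHom.transferCenterPow N) ⟨a, haN⟩ ⟨b, hbN⟩)
    simp only [MonoidHom.transferCenterPow_apply, Subgroup.coe_mul, Subgroup.coe_pow] at h1
    rw [h1]
    have h2 := (MonoidHom.transferCenterPow N ⟨a, haN⟩).2
    rw [MonoidHom.transferCenterPow_apply] at h2
    refine .mul_of_commute ?_ (ha.pow _) (hb.pow _)
    exact (congrArg Subtype.val (Subgroup.mem_center_iff.1 h2
      (⟨b, hbN⟩ ^ (Subgroup.center N).index))).symm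
  inv_mem' := fun h => ⟨inv_mem h.1, h.2.inv⟩

/-- A commuting set of semisimple elements with unit eigenvalues is bounded. -/
theorem exists_bound_of_commute {A : Set (SLC n)} (hc : ∀ g ∈ A, ∀ h ∈ A, Commute g h)
    (hss : ∀ g ∈ A, Module.End.IsSemisimple (Matrix.toLin' (g : Matrix (Fin n) (Fin n) ℂ)))
    (hu : ∀ g ∈ A, HasUnitEigs g) (w : Fin n → ℂ) :
    ∃ B : ℝ, ∀ g ∈ A, ‖(g : Matrix (Fin n) (Fin n) ℂ).mulVec w‖ ≤ B := by
  let W : Submodule ℂ (Fin n → ℂ) :=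
    { carrier := {w | ∃ B : ℝ, ∀ g ∈ A, ‖(g : Matrix (Fin n) (Fin n) ℂ).mulVec w‖ ≤ B}
      add_mem' := by
        rintro x y ⟨B, hB⟩ ⟨D, hD⟩
        refine ⟨B + D, fun g hg => ?_⟩
        rw [Matrix.mulVec_add]
        exact (norm_add_le _ _).trans (add_le_add (hB g hg) (hD g hg))
      zero_mem' := ⟨0, fun g _ => by simp⟩
      smul_mem' := by
        rintro c x ⟨B, hB⟩
        refine ⟨‖c‖ * B, fun g hg => ?_⟩
        rw [Matrix.mulVec_smul, norm_smul]
        exact mul_le_mul_of_nonneg_left (hB g hg) (norm_nonneg c) }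
  let f : A → Module.End ℂ (Fin n → ℂ) := fun g =>
    Matrix.toLin' ((g : SLC n) : Matrix (Fin n) (Fin n) ℂ)
  -- Commuting operators have spanning joint generalized eigenspaces. By semisimplicity these are
  -- joint eigenspaces, where every `g ∈ A` preserves norms.
  have htop := Module.End.iSup_iInf_maxGenEigenspace_eq_top_of_iSup_maxGenEigenspace_eq_top_of_commute
    f (fun g h _ => (commute_coe_iff.2 (hc g g.2 h h.2)).map
      (Matrix.toLinAlgEquiv' : _ ≃ₐ[ℂ] Module.End ℂ (Fin n → ℂ)))
    (fun g => Module.End.iSup_maxGenEigenspace_eq_top _)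
  have hW : W = ⊤ := by
    rw [eq_top_iff, ← htop]
    refine iSup_le fun χ x hx => ⟨‖x‖, fun g hg => ?_⟩
    by_cases hx0 : x = 0
    · simp [hx0]
    have h1 := (Submodule.mem_iInf _).1 hx ⟨g, hg⟩
    rw [Module.End.IsFinitelySemisimple.maxGenEigenspace_eq_eigenspace
      (hss g hg).isFinitelySemisimple, Module.End.mem_eigenspace_iff] at h1
    have h2 : (g : Matrix (Fin n) (Fin n) ℂ).mulVec x = χ ⟨g, hg⟩ • x := by simpa [f] using h1
    rw [h2, norm_smul, hu g hg _ ⟨x, hx0, h2⟩, one_mul]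
  exact (hW ▸ Submodule.mem_top : w ∈ W)

theorem exists_bound_unitEigsSubgroup (hfi : (Subgroup.center N).FiniteIndex)
    (hss : ∀ g ∈ N, Module.End.IsSemisimple (Matrix.toLin' (g : Matrix (Fin n) (Fin n) ℂ)))
    (w : Fin n → ℂ) :
    ∃ B : ℝ, ∀ g ∈ unitEigsSubgroup N hfi, ‖(g : Matrix (Fin n) (Fin n) ℂ).mulVec w‖ ≤ B := by
  have hq : ∀ q : N ⧸ Subgroup.center N, ∃ B : ℝ, ∀ g : N, (g : SLC n) ∈ unitEigsSubgroup N hfi →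
      (QuotientGroup.mk g : N ⧸ Subgroup.center N) = q →
      ‖((g : SLC n) : Matrix (Fin n) (Fin n) ℂ).mulVec w‖ ≤ B := by
    intro q
    by_cases hex : ∃ r : N, (r : SLC n) ∈ unitEigsSubgroup N hfi ∧
      (QuotientGroup.mk r : N ⧸ Subgroup.center N) = q
    · obtain ⟨r, hr, rfl⟩ := hex
      obtain ⟨B, hB⟩ := exists_bound_of_commute
        (A := {g : SLC n | HasUnitEigs g ∧ ∃ z ∈ Subgroup.center N, (z : SLC n) = g})
        (by
          rintro _ ⟨-, z, hz, rfl⟩ _ ⟨-, y, hy, rfl⟩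
          exact (congrArg Subtype.val (Subgroup.mem_center_iff.1 hz y)).symm)
        (by
          rintro _ ⟨-, z, hz, rfl⟩
          exact hss z z.2) (fun g hg => hg.1)
        (((r : SLC n) : Matrix (Fin n) (Fin n) ℂ).mulVec w)
      refine ⟨B, fun g hg hgr => ?_⟩
      have hz : r⁻¹ * g ∈ Subgroup.center N := QuotientGroup.eq.1 hgr.symm
      -- On a coset with representative `r`, the commutative bound is applied to the central factor
      -- `r⁻¹ * g` acting on the fixed vector `r w`.
      have h1 : g = (r⁻¹ * g) * r := by
        rw [← Subgroup.mem_center_iff.1 hz r, mul_inv_cancel_left]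
      have h2 := hB ((r⁻¹ * g : N) : SLC n)
        ⟨(mul_mem (inv_mem hr) hg : ((r : SLC n)⁻¹ * g) ∈ unitEigsSubgroup N hfi).2, _, hz, rfl⟩
      rw [Matrix.mulVec_mulVec, ← Matrix.SpecialLinearGroup.coe_mul, ← Subgroup.coe_mul, ← h1] at h2
      exact h2
    · exact ⟨0, fun g hg hgq => absurd ⟨g, hg, hgq⟩ hex⟩
  choose B hB using hq
  have : Finite (N ⧸ Subgroup.center N) := Subgroup.finite_quotient_of_finiteIndex
  obtain ⟨D, hD⟩ := (Set.finite_range B).bddAbove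
  exact ⟨D, fun g hg => (hB _ ⟨g, hg.1⟩ hg rfl).trans (hD ⟨_, rfl⟩)⟩

/-- Boundedness makes the closure a compact subgroup, contained in the closed group `N`. Elements of
compact subgroups have unit eigenvalues, so the closure adds nothing. -/
theorem isCompact_unitEigsSubgroup (hNcl : IsClosed (N : Set (SLC n)))
    (hfi : (Subgroup.center N).FiniteIndex)
    (hss : ∀ g ∈ N, Module.End.IsSemisimple (Matrix.toLin' (g : Matrix (Fin n) (Fin n) ℂ))) :
    IsCompact (unitEigsSubgroup N hfi : Set (SLC n)) := by
  choose B hB using fun j : Fin n => exists_bound_unitEigsSubgroup hfi hss (Pi.single j 1)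
  obtain ⟨D, hD⟩ := (Set.finite_range B).bddAbove
  have hcomp : IsCompact (((↑) : SLC n → Matrix (Fin n) (Fin n) ℂ) ⁻¹'
      (Metric.closedBall (0 : ℂ) D).matrix) :=
    Matrix.SpecialLinearGroup.isClosedEmbedding_val.isCompact_preimage
      (isCompact_closedBall (0 : ℂ) D).matrix
  have hsub : (unitEigsSubgroup N hfi : Set (SLC n)) ⊆ ((↑) : SLC n → Matrix (Fin n) (Fin n) ℂ) ⁻¹'
      (Metric.closedBall (0 : ℂ) D).matrix := by
    intro g hg i j
    rw [mem_closedBall_zero_iff]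
    have h1 := (norm_le_pi_norm _ i).trans ((hB j g hg).trans (hD ⟨j, rfl⟩))
    simpa using h1
  have hcl : IsCompact ((unitEigsSubgroup N hfi).topologicalClosure : Set (SLC n)) :=
    hcomp.closure_of_subset hsub
  have hKN : unitEigsSubgroup N hfi ≤ N := fun g hg => hg.1
  have hle : (unitEigsSubgroup N hfi).topologicalClosure ≤ unitEigsSubgroup N hfi := fun g hg =>
    ⟨Subgroup.topologicalClosure_minimal _ hKN hNcl hg, .of_isCompact hcl hg⟩
  rwa [le_antisymm hle (Subgroup.le_topologicalClosure _)] at hcl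

/-- The unit-eigenvalue subgroup is not merely maximal but the greatest compact subgroup of `N`,
whence uniqueness. -/
theorem existsUnique_isMaximalCompactSubgroup (hNcl : IsClosed (N : Set (SLC n)))
    (hfi : (Subgroup.center N).FiniteIndex)
    (hss : ∀ g ∈ N, Module.End.IsSemisimple (Matrix.toLin' (g : Matrix (Fin n) (Fin n) ℂ))) :
    ∃! C : Subgroup (SLC n), IsMaximalCompactSubgroup N C := by
  have hK := isCompact_unitEigsSubgroup hNcl hfi hss
  have hKN : unitEigsSubgroup N hfi ≤ N := fun g hg => hg.1
  have hmax : ∀ H : Subgroup (SLC n), H ≤ N → IsCompact (H : Set (SLC n)) →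
      H ≤ unitEigsSubgroup N hfi := fun H hHN hH g hg => ⟨hHN hg, .of_isCompact hH hg⟩
  refine ⟨unitEigsSubgroup N hfi, ⟨⟨hKN, hK⟩, fun H hH _ => hmax H hH.1 hH.2⟩, fun C hC => ?_⟩
  exact le_antisymm (hmax C hC.1.1 hC.1.2) (hC.2 ⟨hKN, hK⟩ (hmax C hC.1.1 hC.1.2))

theorem isClosed_of_isZariskiClosed {G : Subgroup (SLC n)} (hG : IsZariskiClosed G) :
    IsClosed (G : Set (SLC n)) := by
  obtain ⟨S, hS⟩ := isClosed_zariski_iff.1 hG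
  have h1 : (G : Set (SLC n)) =
      ⋂ p ∈ S, {g : SLC n | entryEval (g : Matrix (Fin n) (Fin n) ℂ) p = 0} := by
    rw [hS]
    ext g
    simp
  rw [h1]
  refine isClosed_biInter fun p _ => isClosed_singleton.preimage (?_ : Continuous _)
  refine (MvPolynomial.continuous_eval p).comp (continuous_pi fun ij => ?_)
  fun_prop

theorem isClosed_realPoints {G : Subgroup (SLC n)} (hG : IsZariskiClosed G) :
    IsClosed (realPoints G : Set (SLC n)) := by
  have h1 : (realPoints G : Set (SLC n)) = (G : Set (SLC n)) ∩ {g | conjSL g = g} := by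
    ext g
    exact mem_realPoints_iff
  have h2 : Continuous (conjSL : SLC n → SLC n) :=
    Continuous.specialLinearGroup_map Complex.continuous_conj
  rw [h1]
  have : T2Space (SLC n) :=
    Matrix.SpecialLinearGroup.isClosedEmbedding_val.isEmbedding.t2Space
  exact (isClosed_of_isZariskiClosed hG).inter (isClosed_eq h2 continuous_id)

end AlgGroup

theorem mainTheorem5 (n : ℕ) (G N : Subgroup (AlgGroup.SLC n))
    (hG : AlgGroup.IsZariskiClosed G) (hred : AlgGroup.IsReductive G)
    (hN : N = G ∨ (AlgGroup.IsDefinedOverReal G ∧ N = AlgGroup.realPoints G))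
    (hnil : Group.IsNilpotent N) :
    (∀ g ∈ N, AlgGroup.IsSemisimpleElement g) ∧
    (∃! C : Subgroup (AlgGroup.SLC n), AlgGroup.IsMaximalCompactSubgroup N C) ∧
    AlgGroup.identityComponent N ⊆
      ((Subgroup.center N).map N.subtype : Set (AlgGroup.SLC n)) := by
  have hss : ∀ g ∈ N, Module.End.IsSemisimple
      (Matrix.toLin' (g : Matrix (Fin n) (Fin n) ℂ)) := fun g hg =>
    AlgGroup.isSemisimple_of_mem hG hred hN hnil hg
  have hss' : ∀ g ∈ N, AlgGroup.IsSemisimpleElement g := fun g hg =>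
    AlgGroup.isSemisimpleEnd_of_isSemisimple (hss g hg)
  have hC := AlgGroup.identityComponent_subset_center hnil hss'
  refine ⟨hss', AlgGroup.existsUnique_isMaximalCompactSubgroup ?_
    (AlgGroup.finiteIndex_center hC) hss, hC⟩
  rcases hN with rfl | ⟨-, rfl⟩
  · exact AlgGroup.isClosed_of_isZariskiClosed hG
  · exact AlgGroup.isClosed_realPoints hG
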